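/- **The automorphism group of the minimal Robinson system is spanned by the two shifts.** *Tiles.* A Robinson tile is a unit square each of whose four edges is crossed perpendicularly by a central arrow, which may be doubled by one parallel side arrow shifted to one side of it. There are 28 tiles $\mathcal A$: the four *crosses* (all central arrows leave the tile; the tile faces one of the corners, and exactly the two arrows towards the edges adjacent to this corner are doubled, on the side of this corner), and 24 *arms* (a principal arrow runs straight through the tile in one of the four directions, with a side arrow on its left, on its right, or none; two arrows enter through the two other edges, and either both are single or both have a side arrow on the side of the tail of the principal arrow). Let $Y\subseteq\mathcal A^{\mathbb Z^2}$ be the set of configurations in which the arrows (central and side) of adjacent tiles match along the common edge and for which there is $\vec n\in\mathbb Z^2$ with a cross at each position of $\vec n+2\mathbb Z^2$. Let $(\sigma_{(1,0)}x)_{i,j}=x_{i+1,j}$ and $(\sigma_{(0,1)}x)_{i,j}=x_{i,j+1}$. A subshift is a closed set invariant under $\sigma_{(1,0)}^{\pm1},\sigma_{(0,1)}^{\pm1}$; a minimal subsystem is a nonempty subshift in which every orbit is dense. *Relations.* For commuting homeomorphisms $S,T$ of $X$ let $\mathbf Q_{S,T}(X)=\overline{\{(x,S^nx,T^mx,S^nT^mx):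 x\in X,\ n,m\in\mathbb Z\}}\subseteq X^4$, and let $(x,y)\in\mathcal R_{S,T}(X)$ mean that $(x,y,a,a)\in\mathbf Q_{S,T}(X)$ and $(x,b,y,b)\in\mathbf Q_{S,T}(X)$ for some $a,b\in X$. A fault line of a configuration is a horizontal or vertical line of $\mathbb Z^2$ on which it has at most one cross. An automorphism of $(X,S,T)$ is a homeomorphism of $X$ that commutes with every element of the group spanned by $S$ and $T$. *Statement.* $Y$ has exactly one minimal subsystem $X_R$. Put $S=\sigma_{(1,0)}|_{X_R}$ and $T=\sigma_{(0,1)}|_{X_R}$. Then: 1. If $(x,y)\in\mathcal R_{S,T}(X_R)$, then $x$ and $y$ have the same fault lines and coincide in the complement of these lines. In particular a point without fault lines is $\mathcal R_{S,T}(X_R)$-related to no other point. 2. For $x,y\in X_R$: $x$ and $y$ have the same fault lines and coincide in the complement of these lines if and only if $(x,y)$ belongs to the equivalence relation generated by $\mathcal R_{S,T}(X_R)$. 3. The group of automorphisms of $(X_R,S,T)$ is spanned by $\sigma_{(1,0)}$ and $\sigma_{(0,1)}$; that is, it equals the subgroup generated by $S$ and $T$, and every automorphism is of the form $S^nT^m$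 with $n,m\in\mathbb Z$. -/

import Mathlib

/-! ### Cubes and regionally proximal relations of a system with commuting transformations -/

namespace CubeSystem

variable {X : Type*} [TopologicalSpace X]

/-- The group `G = {Sⁿ Tᵐ}` of homeomorphisms spanned by `S` and `T`. -/
def actingGroup (S T : X ≃ₜ X) : Subgroup (X ≃ₜ X) := Subgroup.closure {S, T}

/-- `(X, S, T)` is minimal: the orbit of every point is dense. -/
def IsMinimal (S T : X ≃ₜ X) : Prop :=
  ∀ x : X, Dense {y : X | ∃ g ∈ actingGroup S T, y = g x}

/-- The space of cubes `Q_{S,T}(X)`: the closure in `X⁴` of the set of points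
`(x, Sⁿ x, Tᵐ x, Sⁿ Tᵐ x)`. -/
def cubes (S T : X ≃ₜ X) : Set (X × X × X × X) :=
  closure {w | ∃ (x : X) (n m : ℤ),
    w = (x, (S ^ n) x, (T ^ m) x, (S ^ n) ((T ^ m) x))}

/-- The relation `R_S(X)`. -/
def relS (S T : X ≃ₜ X) (x y : X) : Prop := ∃ a : X, (x, y, a, a) ∈ cubes S T

/-- The relation `R_T(X)`. -/
def relT (S T : X ≃ₜ X) (x y : X) : Prop := ∃ b : X, (x, b, y, b) ∈ cubes S T

/-- The `(S,T)`-regionally proximal relation `R_{S,T}(X) = R_S(X) ∩ R_T(X)`. -/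
def relST (S T : X ≃ₜ X) (x y : X) : Prop := relS S T x y ∧ relT S T x y

/-- The group of automorphisms of `(X, S, T)`: the homeomorphisms of `X` that commute with
every element of the acting group. -/
def automorphismGroup (S T : X ≃ₜ X) : Subgroup (X ≃ₜ X) :=
  Subgroup.centralizer (actingGroup S T : Set (X ≃ₜ X))

end CubeSystem

/-! ### The Robinson tiles -/

namespace Robinson

/-- The 28 Robinson tiles. Every edge of a tile is crossed perpendicularly by a central arrow,
which may be doubled by one parallel side arrow, shifted to one of its two sides.
In `ℤ × ℤ` the first coordinate grows to the right (east) and the second one upwards (north).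

* `cross east north` : four central arrows leave the tile; the tile faces one of the four
  corners, and exactly the two arrows towards the adjacent edges are doubled, on the side of that
  corner (4 tiles).
* `horizontalArm east side doubled` : the principal arrow runs through the tile from left to right
  (`east = true`) or from right to left (`east = false`), with a side arrow above it (`side = 1`),
  below it (`side = -1`), or none (`side = 0`). Two arrows enter from above and from below;
  either both are single, or (`doubled = true`) both have a side arrow on the side of the tail
  of the principal arrow (12 tiles).
* `verticalArm north side doubled` : the same with the axes exchanged; the principal arrow
  runs upwards if `north = true`, and `side = 1` means a side arrow on its right (12 tiles).

Up to rotations and reflections these are five tiles: the cross, and the arms with single or doubled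
principal arrow and single or doubled transverse arrows. -/
inductive Tile : Type
  | cross (east north : Bool) : Tile
  | horizontalArm (east : Bool) (side : SignType) (doubled : Bool) : Tile
  | verticalArm (north : Bool) (side : SignType) (doubled : Bool) : Tile

/-- What is seen on an edge of a tile: whether the arrow crossing the edge points in the positive
direction (to the right, resp. upwards), and the position of the side arrow relative to the
central arrow (`1` above, resp. to the right; `-1` below, resp. to the left; `0` no side
arrow). -/
structure EdgeMark : Type where
  positive : Bool
  side : SignType

/-- The sign of a direction along an axis. -/
def axisSign (b : Bool) : SignType := if b then 1 else -1

/-- The mark on the right edge. -/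
def Tile.right : Tile → EdgeMark
  | .cross e n => ⟨true, if e then axisSign n else 0⟩
  | .horizontalArm e s _ => ⟨e, s⟩
  | .verticalArm n _ d => ⟨false, if d then axisSign (!n) else 0⟩

/-- The mark on the left edge. -/
def Tile.left : Tile → EdgeMark
  | .cross e n => ⟨false, if e then 0 else axisSign n⟩
  | .horizontalArm e s _ => ⟨e, s⟩
  | .verticalArm n _ d => ⟨true, if d then axisSign (!n) else 0⟩

/-- The mark on the top edge. -/
def Tile.top : Tile → EdgeMark
  | .cross e n => ⟨true, if n then axisSign e else 0⟩
  | .horizontalArm e _ d => ⟨false, if d then axisSign (!e) else 0⟩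
  | .verticalArm n s _ => ⟨n, s⟩

/-- The mark on the bottom edge. -/
def Tile.bottom : Tile → EdgeMark
  | .cross e n => ⟨false, if n then 0 else axisSign e⟩
  | .horizontalArm e _ d => ⟨true, if d then axisSign (!e) else 0⟩
  | .verticalArm n s _ => ⟨n, s⟩

/-- The tile is a cross. -/
def Tile.IsCross (t : Tile) : Prop := ∃ e n : Bool, t = .cross e n

/-- The finite alphabet of tiles carries the discrete topology. -/
instance : TopologicalSpace Tile := ⊥

instance : DiscreteTopology Tile := ⟨rfl⟩

/-! ### The full shift, subshifts and the minimal Robinson system -/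

/-- The full shift over the Robinson tiles, with the product topology. -/
abbrev Config : Type := ℤ × ℤ → Tile

/-- The translation `(σ_v x)_p = x_{p+v}` as a homeomorphism of the full shift. -/
def shift (v : ℤ × ℤ) : Config ≃ₜ Config where
  toFun x p := x (p + v)
  invFun x p := x (p - v)
  left_inv x := by funext p; simp
  right_inv x := by funext p; simp
  continuous_toFun := continuous_pi fun p => continuous_apply (p + v)
  continuous_invFun := continuous_pi fun p => continuous_apply (p - v)

/-- A two-dimensional subshift: a closed subset invariant under `σ_(1,0)` and `σ_(0,1)`
(and their inverses). -/
structure IsSubshift (X : Set Config) : Prop where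
  isClosed : IsClosed X
  mem_shift₁ : ∀ x, x ∈ X ↔ shift (1, 0) x ∈ X
  mem_shift₂ : ∀ x, x ∈ X ↔ shift (0, 1) x ∈ X

/-- The homeomorphism `σ_(1,0)` of a subshift. -/
def IsSubshift.σ₁ {X : Set Config} (h : IsSubshift X) : X ≃ₜ X :=
  (shift (1, 0)).subtype h.mem_shift₁

/-- The homeomorphism `σ_(0,1)` of a subshift. -/
def IsSubshift.σ₂ {X : Set Config} (h : IsSubshift X) : X ≃ₜ X :=
  (shift (0, 1)).subtype h.mem_shift₂

/-- `X` is a minimal subsystem of `Y`: a nonempty subshift contained in `Y` that is minimal for the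
two shifts. -/
structure IsMinimalSubsystem (Y X : Set Config) : Prop where
  subset : X ⊆ Y
  nonempty : X.Nonempty
  isSubshift : IsSubshift X
  isMinimal : CubeSystem.IsMinimal isSubshift.σ₁ isSubshift.σ₂

/-- The Robinson subshift `Y`: the arrows of adjacent tiles match, and there is a translate of
`2ℤ × 2ℤ` at all of whose positions there is a cross. -/
def robinsonShift : Set Config :=
  {x | (∀ i j : ℤ, (x (i, j)).right = (x (i + 1, j)).left) ∧
    (∀ i j : ℤ, (x (i, j)).top = (x (i, j + 1)).bottom) ∧
    ∃ a b : ℤ, ∀ i j : ℤ, (x (a + 2 * i, b + 2 * j)).IsCross}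

/-! ### Fault lines -/

/-- The horizontal line at height `j` is a fault line of `x`: it has at most one cross. -/
def IsHorizontalFaultLine (x : Config) (j : ℤ) : Prop :=
  {i : ℤ | (x (i, j)).IsCross}.Subsingleton

/-- The vertical line at abscissa `i` is a fault line of `x`: it has at most one cross. -/
def IsVerticalFaultLine (x : Config) (i : ℤ) : Prop :=
  {j : ℤ | (x (i, j)).IsCross}.Subsingleton

/-- The union of the fault lines of `x`. -/
def faultSet (x : Config) : Set (ℤ × ℤ) :=
  {p | IsVerticalFaultLine x p.1 ∨ IsHorizontalFaultLine x p.2}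

/-- `x` and `y` have the same fault lines and coincide in the complement of these lines. -/
def CoincideOffFaultLines (x y : Config) : Prop :=
  faultSet x = faultSet y ∧ Set.EqOn x y (faultSet x)ᶜ

end Robinson

/-! Call the exponent of `2` in a coordinate its order. In the hierarchical configuration `cell` the
crosses sit where both coordinates have the same order; elsewhere an arm runs along the line of
higher order. It is matched off the axes, invariant under scaling by powers of `2` (`cell_pow_mul`),
and its tile at a position depends only on the position modulo twice a power of `2` that divides
neither coordinate (`cell_congr`). The minimal system `minimalShift` consists of the configurations
whose patterns occur in the positive quadrant of `cell`.

The combinatorial core is that every point of the Robinson shift contains arbitrarily large squares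
of `cell` (`exists_eq_cell_of_mem`). In a quadrant, two misaligned pairs of neighbouring columns of
crosses would bound a half strip with outward boundary arrows, which a descent excludes
(`Patch.not_exits`). Beyond the misalignments the crosses face one another in fours, the centres of
the fours are crosses that form a quadrant of the same kind, and induction on the scale recovers
`cell` (`Corner.exists_eq_cell`). Hence every pattern of `minimalShift` occurs in every point of the
Robinson shift, which gives minimality and uniqueness.

The fault lines of a point of `minimalShift` are its lines of infinite order, at most one in each
direction. If `(x, y, a, a)` is a cube, a horizontal displacement preserves a large pattern, so it
is divisible by a large power of `2`, and `x`, `y` agree off the fault lines (`sameOffset_of_relS`).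
Conversely, the points that share the complement of their fault lines belong to a family indexed by
tiles, all of whose members are related to one of them (`Realizes.relST`).

An automorphism preserves cubes, hence coincidence off the fault lines. Injectivity forces the image
of a blow-up to have fault lines in both directions, so the image is a translate of a blow-up
(`eq_shift_blowup`). All blow-ups agree off the axes, and translates of one of them approximate
every point, so the automorphism is that translation (`exists_eq_zpow`). -/

namespace Robinson

/-! ### Local constraints on tiles -/

/-- The horizontal direction in which a cross faces (`false` for an arm). -/
def Tile.facesEast : Tile → Bool
  | .cross e _ => e
  | _ => false

/-- The vertical direction in which a cross faces (`false` for an arm). -/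
def Tile.facesNorth : Tile → Bool
  | .cross _ n => n
  | _ => false

/-- The tile is a vertical arm. -/
def Tile.IsVertical (t : Tile) : Prop := ∃ n s d, t = .verticalArm n s d

/-- The reflection of a tile along the diagonal. -/
def Tile.transpose : Tile → Tile
  | .cross e n => .cross n e
  | .horizontalArm e s d => .verticalArm e s d
  | .verticalArm n s d => .horizontalArm n s d

@[simp] theorem Tile.transpose_transpose (t : Tile) : t.transpose.transpose = t := by
  cases t <;> rfl

@[simp] theorem Tile.transpose_right (t : Tile) : t.transpose.right = t.top := by
  cases t <;> rfl

@[simp] theorem Tile.transpose_left (t : Tile) : t.transpose.left = t.bottom := by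
  cases t <;> rfl

@[simp] theorem Tile.transpose_top (t : Tile) : t.transpose.top = t.right := by
  cases t <;> rfl

@[simp] theorem Tile.transpose_bottom (t : Tile) : t.transpose.bottom = t.left := by
  cases t <;> rfl

theorem Tile.IsCross.eq {t : Tile} (h : t.IsCross) : t = .cross t.facesEast t.facesNorth := by
  obtain ⟨e, n, rfl⟩ := h
  rfl

@[simp] theorem Tile.isCross_cross (e n : Bool) : (Tile.cross e n).IsCross := ⟨e, n, rfl⟩

@[simp] theorem Tile.not_isCross_horizontalArm (e s d) : ¬ (Tile.horizontalArm e s d).IsCross := by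
  rintro ⟨_, _, h⟩
  cases h

@[simp] theorem Tile.not_isCross_verticalArm (n s d) : ¬ (Tile.verticalArm n s d).IsCross := by
  rintro ⟨_, _, h⟩
  cases h

@[simp] theorem Tile.isCross_transpose (t : Tile) : t.transpose.IsCross ↔ t.IsCross := by
  cases t <;> simp [Tile.transpose]

@[simp] theorem Tile.facesEast_transpose (t : Tile) : t.transpose.facesEast = t.facesNorth := by
  cases t <;> rfl

@[simp] theorem Tile.facesNorth_transpose (t : Tile) : t.transpose.facesNorth = t.facesEast := by
  cases t <;> rfl

theorem axisSign_injective : Function.Injective axisSign := by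
  intro a b
  cases a <;> cases b <;> simp [axisSign]

@[simp] theorem axisSign_ne_zero (b : Bool) : axisSign b ≠ 0 := by
  cases b <;> simp [axisSign]

@[simp] theorem zero_ne_axisSign (b : Bool) : 0 ≠ axisSign b := (axisSign_ne_zero b).symm

@[simp] theorem axisSign_inj {a b : Bool} : axisSign a = axisSign b ↔ a = b :=
  axisSign_injective.eq_iff

/-- A tile is determined by its left, top and bottom marks. -/
theorem Tile.eq_of_marks {t t' : Tile} (hl : t.left = t'.left) (ht : t.top = t'.top)
    (hb : t.bottom = t'.bottom) : t = t' := by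
  revert hl ht hb
  cases t <;> cases t' <;> simp only [Tile.left, Tile.top, Tile.bottom, EdgeMark.mk.injEq] <;>
    grind [axisSign_ne_zero, axisSign_injective.eq_iff]

theorem Tile.isCross_of_left_right {t : Tile} (hl : t.left.positive = false)
    (hr : t.right.positive = true) : t.IsCross := by
  cases t <;> simp_all [Tile.left, Tile.right]

/-- The tile between two horizontally consecutive crosses. -/
theorem between_horizontal {a b c : Tile} (ha : a.IsCross) (hc : c.IsCross)
    (hab : a.right = b.left) (hbc : b.right = c.left) :
    c.facesEast = !a.facesEast ∧ (a.facesEast = true → c.facesNorth = a.facesNorth) ∧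
    b.IsVertical ∧
    (a.facesEast = true → b.top.positive = !a.facesNorth) := by
  obtain ⟨e, n, rfl⟩ := ha
  obtain ⟨e', n', rfl⟩ := hc
  -- Arrows enter `b` from the left and from the right, which only a vertical arm admits; its
  -- transverse arrows are doubled together, both on the tail side of the principal arrow.
  cases b with
  | cross => simp [Tile.left, Tile.right] at hab
  | horizontalArm e s d => simp_all [Tile.left, Tile.right]
  | verticalArm k s d =>
    cases e <;> cases e' <;> cases d <;>
      simp_all [Tile.left, Tile.right, Tile.facesEast, Tile.facesNorth, Tile.IsVertical, Tile.top]

/-- The tile between two vertically consecutive crosses. -/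
theorem between_vertical {a b c : Tile} (ha : a.IsCross) (hc : c.IsCross)
    (hab : a.top = b.bottom) (hbc : b.top = c.bottom) :
    c.facesNorth = !a.facesNorth ∧ (a.facesNorth = true → c.facesEast = a.facesEast) ∧
    b.transpose.IsVertical ∧
    (a.facesNorth = true → b.right.positive = !a.facesEast) := by
  simpa using between_horizontal (a := a.transpose) (b := b.transpose) (c := c.transpose)
    (by simpa) (by simpa) (by simpa) (by simpa)

theorem Tile.IsVertical.top_eq {t : Tile} (h : t.IsVertical) : t.top = t.bottom := by
  obtain ⟨n, s, d, rfl⟩ := h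
  rfl

theorem Tile.IsVertical.right_positive {t : Tile} (h : t.IsVertical) :
    t.right.positive = false := by
  obtain ⟨n, s, d, rfl⟩ := h
  rfl

theorem Tile.IsVertical.left_positive {t : Tile} (h : t.IsVertical) :
    t.left.positive = true := by
  obtain ⟨n, s, d, rfl⟩ := h
  rfl

theorem Tile.IsVertical.not_isCross {t : Tile} (h : t.IsVertical) : ¬ t.IsCross := by
  obtain ⟨n, s, d, rfl⟩ := h
  simp

theorem Tile.right_eq_left_of_transpose {t : Tile} (h : t.transpose.IsVertical) :
    t.right = t.left := by
  simpa using h.top_eq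

/-- A column without crosses consists of vertical arms above some height. -/
theorem eventually_vertical {f : ℤ → Tile} (hv : ∀ j, 0 < j → (f j).top = (f (j + 1)).bottom)
    (hf : ∀ j, 0 < j → ¬ (f j).IsCross) : ∃ J : ℤ, 0 ≤ J ∧ ∀ j, J < j → (f j).IsVertical := by
  by_cases h : ∀ j, 0 < j → (f j).IsVertical
  · exact ⟨0, le_rfl, h⟩
  push Not at h
  obtain ⟨J, hJ, hn⟩ := h
  -- The tile at `J` is a horizontal arm, whose upper arrow points down. A tile that is not a cross
  -- and has a downward arrow on its lower edge is a downward vertical arm, so this propagates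
  -- upwards.
  have key : ∀ k : ℕ, (f (J + k)).top.positive = false ∧ (0 < k → (f (J + k)).IsVertical) := by
    intro k
    induction k with
    | zero =>
      have h1 := hf J hJ
      revert hn h1
      cases hfJ : f J <;> simp [Tile.IsVertical, Tile.top, hfJ]
    | succ k ih =>
      have h1 := hv (J + k) (by lia)
      have h2 := hf (J + k + 1) (by lia)
      rw [h1] at ih
      push_cast
      rw [← add_assoc]
      revert ih h2
      cases f (J + k + 1) <;> simp +contextual [Tile.IsVertical, Tile.top, Tile.bottom]
  refine ⟨J, hJ.le, fun j hj => ?_⟩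
  have := (key (j - J).toNat).2 (by lia)
  rwa [Int.toNat_of_nonneg (by lia), add_sub_cancel] at this

/-! ### Strips and quadrants of crosses -/

/-- A half strip, of which the columns `1, …, 2 k - 1` and the rows `1, 2, …` are matched, with
crosses at the positions with odd coordinates. -/
structure Patch (y : Config) (k : ℤ) : Prop where
  right : ∀ i j, 0 < i → i + 1 < 2 * k → 0 < j → (y (i, j)).right = (y (i + 1, j)).left
  top : ∀ i j, 0 < i → i < 2 * k → 0 < j → (y (i, j)).top = (y (i, j + 1)).bottom
  cross : ∀ i j, 0 ≤ i → i < k → 0 ≤ j → (y (2 * i + 1, 2 * j + 1)).IsCross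

variable {y : Config} {k : ℤ}

theorem Patch.column (h : Patch y k) {i j : ℤ} (hi : 0 ≤ i) (hik : i < k) (hj : 0 ≤ j) :
    (y (2 * i + 1, 2 * (j + 1) + 1)).facesNorth = !(y (2 * i + 1, 2 * j + 1)).facesNorth ∧
    ((y (2 * i + 1, 2 * j + 1)).facesNorth = true →
      (y (2 * i + 1, 2 * (j + 1) + 1)).facesEast = (y (2 * i + 1, 2 * j + 1)).facesEast) ∧
    (y (2 * i + 1, 2 * j + 2)).transpose.IsVertical ∧
    ((y (2 * i + 1, 2 * j + 1)).facesNorth = true →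
      (y (2 * i + 1, 2 * j + 2)).right.positive = !(y (2 * i + 1, 2 * j + 1)).facesEast) := by
  refine between_vertical (h.cross i j hi hik hj) (h.cross i (j + 1) hi hik (by lia)) ?_ ?_
  · rw [h.top _ _ (by lia) (by lia) (by lia)]
    congr 3
    ring
  · rw [h.top _ _ (by lia) (by lia) (by lia)]
    congr 3
    ring

theorem Patch.row (h : Patch y k) {i j : ℤ} (hi : 0 ≤ i) (hik : i + 1 < k) (hj : 0 ≤ j) :
    (y (2 * (i + 1) + 1, 2 * j + 1)).facesEast = !(y (2 * i + 1, 2 * j + 1)).facesEast ∧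
    ((y (2 * i + 1, 2 * j + 1)).facesEast = true →
      (y (2 * (i + 1) + 1, 2 * j + 1)).facesNorth = (y (2 * i + 1, 2 * j + 1)).facesNorth) ∧
    (y (2 * i + 2, 2 * j + 1)).IsVertical ∧
    ((y (2 * i + 1, 2 * j + 1)).facesEast = true →
      (y (2 * i + 2, 2 * j + 1)).top.positive = !(y (2 * i + 1, 2 * j + 1)).facesNorth) := by
  refine between_horizontal (h.cross i j hi (by lia) hj)
    (h.cross (i + 1) j (by lia) hik (by lia)) ?_ ?_
  · rw [h.right _ _ (by lia) (by lia) (by lia)]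
    congr 3
    ring
  · rw [h.right _ _ (by lia) (by lia) (by lia)]
    congr 3
    ring

/-- The vertical orientations of the crosses of neighbouring columns differ in every row if they
differ in one row. -/
theorem Patch.facesNorth_eq (h : Patch y k) {i i' j : ℤ} (hi : 0 ≤ i) (hik : i < k)
    (hi' : 0 ≤ i') (hik' : i' < k) (hj : 0 ≤ j) :
    (y (2 * i + 1, 2 * j + 1)).facesNorth = (y (2 * i' + 1, 2 * j + 1)).facesNorth ↔
      (y (2 * i + 1, 1)).facesNorth = (y (2 * i' + 1, 1)).facesNorth := by
  induction j, hj using Int.leInduction with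
  | base => simp
  | succ j hj ih =>
    rw [(h.column hi hik hj).1, (h.column hi' hik' hj).1, Bool.not_inj_iff, ih]

theorem Patch.facesEast_eq (h : Patch y k) {i j j' : ℤ} (hi : 0 ≤ i) (hik : i < k)
    (hj : 0 ≤ j) (hj' : 0 ≤ j') :
    (y (2 * i + 1, 2 * j + 1)).facesEast = (y (2 * i + 1, 2 * j' + 1)).facesEast ↔
      (y (1, 2 * j + 1)).facesEast = (y (1, 2 * j' + 1)).facesEast := by
  induction i, hi using Int.leInduction with
  | base => simp
  | succ i hi ih =>
    rw [(h.row hi hik hj).1, (h.row hi hik hj').1, Bool.not_inj_iff, ih (by lia)]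

/-- Between two neighbouring columns of crosses that are not aligned there is a column that
consists of vertical arms above some height. -/
theorem Patch.eventually_vertical_of_jump (h : Patch y k) {i : ℤ} (hi : 0 ≤ i) (hik : i + 1 < k)
    (hne : (y (2 * (i + 1) + 1, 1)).facesNorth ≠ (y (2 * i + 1, 1)).facesNorth) :
    ∃ J : ℤ, 0 ≤ J ∧ ∀ j, J < j → (y (2 * i + 2, j)).IsVertical := by
  have hne' : ∀ j, 0 ≤ j → (y (2 * (i + 1) + 1, 2 * j + 1)).facesNorth ≠
      (y (2 * i + 1, 2 * j + 1)).facesNorth := fun j hj he =>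
    hne ((h.facesNorth_eq (by lia) hik hi (by lia) hj).1 he)
  -- A cross facing east would be aligned with its right neighbour.
  have hE : ∀ j, 0 ≤ j → (y (2 * i + 1, 2 * j + 1)).facesEast = false := fun j hj => by
    by_contra he
    exact hne' j hj ((h.row hi hik hj).2.1 (by simpa using he))
  refine eventually_vertical (f := fun j => y (2 * i + 2, j))
    (fun j hj => h.top _ _ (by lia) (by lia) hj) fun j hj => ?_
  obtain ⟨m, rfl | rfl⟩ : ∃ m, j = 2 * m + 1 ∨ j = 2 * m + 2 := ⟨(j - 1) / 2, by lia⟩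
  · exact (h.row hi hik (by lia)).2.2.1.not_isCross
  -- In the odd row below, exactly one of the two neighbouring crosses faces north; the arm above
  -- that one points towards the position considered, which therefore carries no cross.
  · by_cases hn : (y (2 * i + 1, 2 * m + 1)).facesNorth = true
    · have h1 := (h.column (j := m) hi (by lia) (by lia)).2.2.2 hn
      rw [hE m (by lia), h.right _ _ (by lia) (by lia) (by lia)] at h1
      rintro ⟨e, n, hc⟩
      rw [show 2 * i + 1 + 1 = 2 * i + 2 by ring] at h1
      rw [hc] at h1
      simp [Tile.left] at h1
    · have hn' : (y (2 * (i + 1) + 1, 2 * m + 1)).facesNorth = true := by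
        have := hne' m (by lia)
        revert hn this
        cases (y (2 * i + 1, 2 * m + 1)).facesNorth <;> simp
      have hc1 := h.column (i := i + 1) (j := m) (by lia) hik (by lia)
      have h1 := hc1.2.2.2 hn'
      rw [(h.row hi hik (by lia)).1, hE m (by lia), Tile.right_eq_left_of_transpose hc1.2.2.1] at h1
      have h2 := h.right (2 * i + 2) (2 * m + 2) (by lia) (by lia) (by lia)
      rw [show 2 * i + 2 + 1 = 2 * (i + 1) + 1 by ring] at h2
      rw [← h2] at h1
      rintro ⟨e, n, hc⟩
      rw [hc] at h1
      simp [Tile.right] at h1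

/-- The centre of four crosses that face one another is a cross. -/
theorem Patch.cross_centre (h : Patch y k) {i j : ℤ} (hi : 0 ≤ i) (hik : i + 1 < k) (hj : 0 ≤ j)
    (he : (y (2 * i + 1, 2 * j + 1)).facesEast = true)
    (hn : (y (2 * i + 1, 2 * j + 1)).facesNorth = true) :
    (y (2 * i + 2, 2 * j + 2)).IsCross := by
  have hrow := h.row hi hik hj
  -- The arms on both sides of the centre point away from it.
  have h1 := (h.column hi (by lia) hj).2.2.2 hn
  have h2 := h.column (i := i + 1) (by lia) hik hj
  have h3 := h2.2.2.2 (by rw [hrow.2.1 he, hn])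
  rw [hrow.1, he, Tile.right_eq_left_of_transpose h2.2.2.1] at h3
  rw [he, h.right _ _ (by lia) (by lia) (by lia)] at h1
  have h4 := h.right (2 * i + 2) (2 * j + 2) (by lia) (by lia) (by lia)
  rw [show 2 * i + 2 + 1 = 2 * (i + 1) + 1 by ring] at h4
  rw [← h4] at h3
  exact Tile.isCross_of_left_right (by simpa [add_assoc] using h1) (by simpa using h3)

/-- Passing to every second column and every second row. -/
theorem Patch.coarsen (h : Patch y k) {k' b : ℤ} (hk : 2 * k' ≤ k) (hb : 0 ≤ b)
    (hE : ∀ i j, 0 ≤ i → i < k' → 0 ≤ j →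
      (y (2 * (2 * i) + 1, 2 * (b + 2 * j) + 1)).facesEast = true)
    (hN : ∀ i j, 0 ≤ i → i < k' → 0 ≤ j →
      (y (2 * (2 * i) + 1, 2 * (b + 2 * j) + 1)).facesNorth = true) :
    Patch (fun p => y (2 * p.1, 2 * (b + p.2))) k' where
  right i j hi hik hj := by
    -- The tile in between is a horizontal arm, which passes its mark on unchanged.
    have h1 := (h.column (i := i) (j := b + j - 1) (by lia) (by lia) (by lia)).2.2.1
    rw [show 2 * (b + j - 1) + 2 = 2 * (b + j) by ring] at h1
    simp only
    rw [h.right _ _ (by lia) (by lia) (by lia), ← Tile.right_eq_left_of_transpose h1,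
      h.right _ _ (by lia) (by lia) (by lia)]
    congr 3
    ring
  top i j hi hik hj := by
    have h1 := (h.row (i := i - 1) (j := b + j) (by lia) (by lia) (by lia)).2.2.1
    rw [show 2 * (i - 1) + 2 = 2 * i by ring] at h1
    simp only
    rw [h.top _ _ (by lia) (by lia) (by lia), ← h1.top_eq,
      h.top _ _ (by lia) (by lia) (by lia)]
    congr 3
    ring
  cross i j hi hik hj := by
    have := h.cross_centre (i := 2 * i) (j := b + 2 * j) (by lia) (by lia) (by lia)
      (hE i j hi hik hj) (hN i j hi hik hj)
    simp only
    convert this using 3 <;> ring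

theorem Patch.translate {k' a b : ℤ} (h : Patch y k) (ha : 0 ≤ a) (hb : 0 ≤ b)
    (hk : a + k' ≤ k) : Patch (fun p => y (2 * a + p.1, 2 * b + p.2)) k' where
  right i j hi hik hj := by
    simp only
    rw [h.right _ _ (by lia) (by lia) (by lia), add_assoc]
  top i j hi hik hj := by
    simp only
    rw [h.top _ _ (by lia) (by lia) (by lia), add_assoc]
  cross i j hi hik hj := by
    have := h.cross (a + i) (b + j) (by lia) (by lia) (by lia)
    simp only
    convert this using 3 <;> ring

/-- There is no half strip all of whose boundary arrows on the left and on the right point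
outwards. -/
theorem Patch.not_exits (h : Patch y k) (hk : 0 < k)
    (hl : ∀ j, 0 < j → (y (1, j)).left.positive = false)
    (hr : ∀ j, 0 < j → (y (2 * k - 1, j)).right.positive = true) : False := by
  -- Descent on the number of columns of crosses: a misaligned strip is cut at the misalignment, an
  -- aligned one is coarsened to half its width.
  obtain ⟨m, rfl⟩ := Int.eq_ofNat_of_zero_le hk.le
  induction m using Nat.strong_induction_on generalizing y with
  | _ m ih =>
  set k : ℤ := (m : ℤ) with hkm
  have alt : ∀ i j, 0 ≤ i → i < k → 0 ≤ j → (y (2 * i + 1, 2 * j + 1)).facesEast =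
      xor (decide (i % 2 = 1)) (y (1, 2 * j + 1)).facesEast := by
    intro i j hi
    induction i, hi using Int.leInduction with
    | base => simp
    | succ i hi ih2 =>
      intro hik hj
      rw [(h.row hi hik hj).1, ih2 (by lia) hj]
      rcases Int.emod_two_eq_zero_or_one i with h0 | h0
      · simp [h0, show (i + 1) % 2 = 1 by lia]
      · simp [h0, show (i + 1) % 2 = 0 by lia]
  -- The arm above a leftmost cross facing north must point west, out of the strip, which makes the
  -- cross face east.
  have hE0' : ∀ j, 0 ≤ j → (y (1, 2 * j + 1)).facesNorth = true →
      (y (1, 2 * j + 1)).facesEast = true ∧ (y (1, 2 * (j + 1) + 1)).facesEast = true := by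
    intro j hj hn
    have hc := h.column (i := 0) le_rfl hk hj
    simp only [mul_zero, zero_add] at hc
    have h1 := hc.2.2.2 hn
    rw [Tile.right_eq_left_of_transpose hc.2.2.1, hl _ (by lia)] at h1
    have : (y (1, 2 * j + 1)).facesEast = true := by simpa using h1.symm
    exact ⟨this, by rw [hc.2.1 hn, this]⟩
  have hE0 : ∀ j, 0 < j → (y (1, 2 * j + 1)).facesEast = true := by
    intro j hj
    by_cases hn : (y (1, 2 * j + 1)).facesNorth = true
    · exact (hE0' j hj.le hn).1
    · have hc := (h.column (i := 0) (j := j - 1) le_rfl hk (by lia)).1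
      simp only [mul_zero, zero_add, sub_add_cancel] at hc
      have := (hE0' (j - 1) (by lia) (by rw [hc] at hn; simpa using hn)).2
      simpa using this
  -- With an odd number of columns the last one would face east like the first, and the arm above
  -- one of its crosses facing north would point into the strip.
  have hEk : k % 2 = 0 := by
    by_contra hodd
    have hlast : ∀ j, 0 < j → (y (2 * (k - 1) + 1, 2 * j + 1)).facesEast = true := by
      intro j hj
      rw [alt _ _ (by lia) (by lia) hj.le, hE0 j hj]
      simp [show (k - 1) % 2 = 0 by lia]
    have hc1 := h.column (i := k - 1) (j := 1) (by lia) (by lia) (by lia)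
    have hc2 := h.column (i := k - 1) (j := 2) (by lia) (by lia) (by lia)
    by_cases hn : (y (2 * (k - 1) + 1, 2 * 1 + 1)).facesNorth = true
    · have := hc1.2.2.2 hn
      rw [hlast 1 (by lia), show 2 * (k - 1) + 1 = 2 * k - 1 by ring, hr _ (by lia)] at this
      simp at this
    · have hn2 : (y (2 * (k - 1) + 1, 2 * 2 + 1)).facesNorth = true := by
        have := hc1.1
        rw [show (1 : ℤ) + 1 = 2 by norm_num] at this
        rw [this]
        simpa using hn
      have := hc2.2.2.2 hn2
      rw [hlast 2 (by lia), show 2 * (k - 1) + 1 = 2 * k - 1 by ring, hr _ (by lia)] at this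
      simp at this
  by_cases hjump : ∃ i, 0 ≤ i ∧ i + 1 < k ∧
      (y (2 * (i + 1) + 1, 1)).facesNorth ≠ (y (2 * i + 1, 1)).facesNorth
  · obtain ⟨i, hi, hik, hne⟩ := hjump
    obtain ⟨J, hJ, hV⟩ := h.eventually_vertical_of_jump hi hik hne
    -- Vertical arms receive arrows from their left, so the part of the strip before the jump has
    -- outward boundary arrows again.
    refine ih (i + 1).toNat (by lia) (y := fun p => y (2 * 0 + p.1, 2 * J + p.2)) (fun j hj => ?_)
      (h.translate le_rfl hJ (by lia)) (by lia) (fun j hj => ?_)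
    · simpa using hl _ (by lia)
    · have := h.right (2 * i + 1) (2 * J + j) (by lia) (by lia) (by lia)
      rw [Int.toNat_of_nonneg (by lia)]
      simp only
      rw [show 2 * 0 + (2 * (i + 1) - 1) = 2 * i + 1 by ring, this]
      have hVj := hV (2 * J + j) (by lia)
      rw [show 2 * i + 2 = 2 * i + 1 + 1 by ring] at hVj
      exact hVj.left_positive
  · push Not at hjump
    have hN0 : ∀ i, 0 ≤ i → i < k → (y (2 * i + 1, 1)).facesNorth = (y (1, 1)).facesNorth := by
      intro i hi
      induction i, hi using Int.leInduction with
      | base => simp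
      | succ i hi ih2 =>
        intro hik
        rw [hjump i hi hik, ih2 (by lia)]
    obtain ⟨b, hb, hbN⟩ : ∃ b, 0 ≤ b ∧ (y (1, 2 * b + 1)).facesNorth = true := by
      by_cases h1 : (y (1, 1)).facesNorth = true
      · exact ⟨0, le_rfl, by simpa⟩
      · refine ⟨1, by lia, ?_⟩
        have := (h.column (i := 0) (j := 0) le_rfl hk le_rfl).1
        simp only [mul_zero, zero_add] at this
        rw [this]
        simpa using h1
    have hN1 : ∀ j, 0 ≤ j → (y (1, 2 * (b + 2 * j) + 1)).facesNorth = true := by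
      intro j hj
      induction j, hj using Int.leInduction with
      | base => simpa
      | succ j hj ih2 =>
        have e1 := (h.column (i := 0) (j := b + 2 * j) le_rfl hk (by lia)).1
        have e2 := (h.column (i := 0) (j := b + 2 * j + 1) le_rfl hk (by lia)).1
        simp only [mul_zero, zero_add] at e1 e2
        rw [show b + 2 * (j + 1) = b + 2 * j + 1 + 1 by ring, e2, e1, ih2]
        rfl
    have hP : Patch (fun p => y (2 * p.1, 2 * (b + p.2))) ((k / 2).toNat : ℤ) := by
      refine h.coarsen (by lia) hb (fun i j hi hik hj => ?_) (fun i j hi hik hj => ?_)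
      · rw [alt _ _ (by lia) (by lia) (by lia), (hE0' _ (by lia) (hN1 j hj)).1]
        simp
      · have h1 := (h.facesNorth_eq (i := 2 * i) (i' := 0) (j := b + 2 * j) (by lia) (by lia)
          le_rfl hk (by lia)).2 (by simpa using hN0 (2 * i) (by lia) (by lia))
        rw [h1]
        simpa using hN1 j hj
    -- The horizontal arms in the even rows of the outermost columns carry the outward arrows to the
    -- boundary of the coarsened strip.
    refine ih (k / 2).toNat (by lia) (y := fun p => y (2 * p.1, 2 * (b + p.2))) (fun j hj => ?_)
      hP (by lia) (fun j hj => ?_)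
    · have h1 := (h.column (i := 0) (j := b + j - 1) le_rfl hk (by lia)).2.2.1
      rw [show 2 * (b + j - 1) + 2 = 2 * (b + j) by ring] at h1
      have h2 := h.right 1 (2 * (b + j)) (by lia) (by lia) (by lia)
      simp only [mul_zero, zero_add] at h1
      simp only
      rw [show 2 * (1 : ℤ) = 1 + 1 by ring, ← h2, Tile.right_eq_left_of_transpose h1]
      exact hl _ (by lia)
    · have h1 := (h.column (i := k - 1) (j := b + j - 1) (by lia) (by lia) (by lia)).2.2.1
      rw [show 2 * (b + j - 1) + 2 = 2 * (b + j) by ring,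
        show 2 * (k - 1) + 1 = 2 * k - 1 by ring] at h1
      have h2 := h.right (2 * k - 2) (2 * (b + j)) (by lia) (by lia) (by lia)
      rw [show 2 * k - 2 + 1 = 2 * k - 1 by ring, ← Tile.right_eq_left_of_transpose h1] at h2
      rw [Int.toNat_of_nonneg (by lia)]
      simp only
      rw [show 2 * (2 * (k / 2) - 1) = 2 * k - 2 by lia, h2]
      exact hr _ (by lia)

end Robinson

namespace Robinson

/-! ### The hierarchical configuration -/

/-- The exponent of `2` in an integer. -/
def val (i : ℤ) : ℕ := padicValInt 2 i

theorem pow_dvd_iff {i : ℤ} (hi : i ≠ 0) {k : ℕ} : (2 : ℤ) ^ k ∣ i ↔ k ≤ val i := by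
  have := padicValInt_dvd_iff (p := 2) k i
  simpa [hi, val] using this

theorem not_pow_dvd_iff {i : ℤ} {k : ℕ} : ¬ (2 : ℤ) ^ k ∣ i ↔ i ≠ 0 ∧ val i < k := by
  rcases eq_or_ne i 0 with rfl | hi
  · simp
  · simp [pow_dvd_iff hi, hi]

theorem val_congr {i i' : ℤ} {k : ℕ} (hi : ¬ (2 : ℤ) ^ k ∣ i) (h : (2 : ℤ) ^ k ∣ i - i') :
    i' ≠ 0 ∧ val i' = val i := by
  have key : ∀ m ≤ k, (2 : ℤ) ^ m ∣ i ↔ (2 : ℤ) ^ m ∣ i' := fun m hm =>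
    dvd_iff_dvd_of_dvd_sub ((pow_dvd_pow 2 hm).trans h)
  have hi' := (not_congr (key k le_rfl)).1 hi
  rw [not_pow_dvd_iff] at hi hi'
  refine ⟨hi'.1, le_antisymm ?_ ?_⟩
  · rw [← pow_dvd_iff hi.1, key _ hi'.2.le, pow_dvd_iff hi'.1]
  · rw [← pow_dvd_iff hi'.1, ← key _ hi.2.le, pow_dvd_iff hi.1]

theorem val_pow_mul {i : ℤ} (hi : i ≠ 0) (k : ℕ) : val (2 ^ k * i) = k + val i := by
  have h2 : (2 : ℤ) ^ k ≠ 0 := by positivity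
  rw [val, padicValInt.mul h2 hi, val]
  congr 1
  have : (2 : ℤ) ^ k = ((2 ^ k : ℕ) : ℤ) := by push_cast; rfl
  rw [this, padicValInt.of_nat]
  simp

theorem val_odd {i : ℤ} (hi : i % 2 = 1) : val i = 0 :=
  padicValInt.eq_zero_of_not_dvd (by push_cast; lia)

theorem exists_eq_pow_mul {i : ℤ} (hi : i ≠ 0) : ∃ o : ℤ, i = 2 ^ val i * (2 * o + 1) := by
  obtain ⟨m, hm⟩ := (pow_dvd_iff hi).2 le_rfl
  have h : ¬ (2 : ℤ) ^ (val i + 1) ∣ i := by simp [pow_dvd_iff hi]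
  have hodd : m % 2 = 1 := by
    by_contra hne
    obtain ⟨l, rfl⟩ : (2 : ℤ) ∣ m := by lia
    exact h ⟨l, by rw [pow_succ, mul_assoc]; exact hm⟩
  exact ⟨m / 2, by rw [show 2 * (m / 2) + 1 = m by lia]; exact hm⟩

/-- The remainder modulo `4` of the quotient by `2 ^ u`. -/
def quarter (u : ℕ) (j : ℤ) : ℤ := j / 2 ^ u % 4

theorem quarter_congr {u k : ℕ} {j j' : ℤ} (hu : u + 2 ≤ k) (h : (2 : ℤ) ^ k ∣ j - j') :
    quarter u j = quarter u j' := by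
  obtain ⟨m, hm⟩ := (pow_dvd_pow (2 : ℤ) hu).trans h
  rw [quarter, quarter, show j = j' + 2 ^ u * (4 * m) by rw [eq_add_of_sub_eq' hm]; ring,
    Int.add_mul_ediv_left _ _ (by positivity)]
  lia

theorem quarter_pow_mul_add {k : ℕ} (u : ℕ) (b : ℤ) {q : ℤ} (h0 : 0 ≤ q) (hq : q < 2 ^ k) :
    quarter (k + u) (2 ^ k * b + q) = quarter u b := by
  rw [quarter, quarter, pow_add, ← Int.ediv_ediv_of_nonneg (by positivity), add_comm,
    Int.add_mul_ediv_left _ _ (by positivity), Int.ediv_eq_zero_of_lt h0 hq, zero_add]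

theorem quarter_pow_mul {k : ℕ} (u : ℕ) (b : ℤ) : quarter (k + u) (2 ^ k * b) = quarter u b := by
  simpa using quarter_pow_mul_add u b le_rfl (by positivity : (0 : ℤ) < 2 ^ k)

/-- The direction in which the crosses at the abscissa (or ordinate) `i` face. -/
def faces (i : ℤ) : Bool := quarter (val i) i = 1

/-- The mark on the upper edge at `(i, j)` (and on the right edge at `(j, i)`). -/
def axisMark (i j : ℤ) : EdgeMark where
  -- On a line of order `u` arrows leave the crosses, at the odd multiples of `2 ^ u`, at both ends.
  -- The quarters `1` and `2` form the segment between two crosses that face each other, the side of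
  -- a square.
  positive := decide (quarter (val i) j % 2 = 1)
  side := if quarter (val i) j = 1 ∨ quarter (val i) j = 2 then axisSign (faces i) else 0

/-- The vertical arm without transverse side arrows on a line with a given mark. -/
def EdgeMark.vertical (m : EdgeMark) : Tile := .verticalArm m.positive m.side false

/-- The horizontal arm without transverse side arrows on a line with a given mark. -/
def EdgeMark.horizontal (m : EdgeMark) : Tile := .horizontalArm m.positive m.side false

/-- The tile at a position with nonzero coordinates of the hierarchical configuration. -/
def cell (i j : ℤ) : Tile :=
  if val i = val j then .cross (faces i) (faces j)
  else if val j < val i then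
    .verticalArm (axisMark i j).positive (axisMark i j).side (decide (val i = val j + 1))
  else .horizontalArm (axisMark j i).positive (axisMark j i).side (decide (val j = val i + 1))

theorem cell_transpose (i j : ℤ) : (cell i j).transpose = cell j i := by
  unfold cell
  rcases lt_trichotomy (val i) (val j) with h | h | h
  · simp [h, h.ne, h.ne', Tile.transpose, h.not_gt]
  · simp [h, Tile.transpose]
  · simp [h, h.ne, h.ne', Tile.transpose, h.not_gt]

theorem isCross_cell {i j : ℤ} : (cell i j).IsCross ↔ val i = val j := by
  unfold cell
  split_ifs <;> simp [*]

theorem cell_eq_vertical {i j : ℤ} (h : val j + 1 < val i) :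
    cell i j = (axisMark i j).vertical := by
  simp [cell, EdgeMark.vertical, show val i ≠ val j by lia, show val j < val i by lia,
    show val i ≠ val j + 1 by lia]

/-! ### Matching of the marks of neighbouring cells. -/

theorem quarter_pow_mul_self (u : ℕ) (m : ℤ) : quarter u (2 ^ u * m) = m % 4 := by
  simp [quarter]

theorem quarter_pow_mul_sub_one (u : ℕ) (m : ℤ) : quarter u (2 ^ u * m - 1) = (m - 1) % 4 := by
  have h : (1 : ℤ) ≤ 2 ^ u := one_le_pow₀ (by norm_num)
  have := quarter_pow_mul_add (k := u) 0 (m - 1) (q := 2 ^ u - 1) (by lia) (by lia)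
  rw [show (2 : ℤ) ^ u * (m - 1) + (2 ^ u - 1) = 2 ^ u * m - 1 by ring] at this
  simpa [quarter] using this

theorem quarter_sub_one {u : ℕ} {j : ℤ} (h : ¬ (2 : ℤ) ^ u ∣ j) :
    quarter u (j - 1) = quarter u j := by
  have h0 : (0 : ℤ) < 2 ^ u := by positivity
  have h1 := Int.emod_pos_of_not_dvd h
  have h2 := Int.emod_lt_of_pos j h0
  have h3 := Int.mul_ediv_add_emod j (2 ^ u)
  have h4 : (j - 1) / 2 ^ u = j / 2 ^ u := by
    rw [show j - 1 = (j % 2 ^ u - 1) + 2 ^ u * (j / 2 ^ u) by lia,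
      Int.add_mul_ediv_left _ _ h0.ne', Int.ediv_eq_zero_of_lt (by lia) (by lia), zero_add]
  rw [quarter, quarter, h4]

theorem faces_eq_of_eq {i o : ℤ} (h : i = 2 ^ val i * (2 * o + 1)) :
    faces i = decide (o % 2 = 0) := by
  have : ∀ u, i = 2 ^ u * (2 * o + 1) → quarter u i = (2 * o + 1) % 4 := by
    rintro u rfl
    exact quarter_pow_mul_self u _
  rw [faces, this _ h, decide_eq_decide]
  lia

/-- The arrow of the transverse line crossed by an arm at distance one in the hierarchy. -/
theorem axisMark_positive_of_val_eq {i j : ℤ} (hi : i ≠ 0) (h : val j = val i + 1) :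
    (axisMark j i).positive = !faces i := by
  obtain ⟨o, ho⟩ := exists_eq_pow_mul hi
  have : quarter (val j) i = o % 4 := by
    have key : ∀ u, i = 2 ^ u * (2 * o + 1) → quarter (u + 1) i = o % 4 := by
      rintro u rfl
      rw [quarter_pow_mul, quarter, pow_one, show (2 * o + 1) / 2 = o by lia]
    rw [h, key _ ho]
  rw [faces_eq_of_eq ho, axisMark, this, ← decide_not, decide_eq_decide]
  lia

/-- The parity of `m` tells whether the line `j` meets the line `i` in the middle of the side of a
square (quotient `2` modulo `4`, doubled arrows) or midway between squares (quotient `0`, single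
arrows). -/
theorem exists_eq_pow_mul_even {i j : ℤ} (hj : j ≠ 0) (h : val i < val j) :
    ∃ m : ℤ, j = 2 ^ val i * (2 * m) ∧ (val j = val i + 1 ↔ m % 2 = 1) := by
  obtain ⟨o, ho⟩ := exists_eq_pow_mul hj
  obtain ⟨d, hd⟩ := Nat.exists_eq_add_of_lt h
  refine ⟨2 ^ d * (2 * o + 1), ?_, ?_⟩
  · conv_lhs => rw [ho, hd]
    ring
  · rcases d with _ | d
    · simp [hd]
    · rw [pow_succ, hd, show 2 ^ d * 2 * (2 * o + 1) = 2 * (2 ^ d * (2 * o + 1)) by ring]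
      lia

/-- The three cases follow the quotient of `j` by `2 ^ val i`: on a vertical arm it is the same for
`j` and `j - 1`; at a cross it is an odd integer, where arrows leave; at a horizontal arm it is an
even integer, where arrows enter. The lateral marks follow by transposition. -/
theorem cell_top_aux {i j : ℤ} (hi : i ≠ 0) (hj : j ≠ 0) :
    (cell i j).top = axisMark i j ∧ (cell i j).bottom = axisMark i (j - 1) := by
  unfold cell
  rcases lt_trichotomy (val j) (val i) with h | h | h
  · have h1 : quarter (val i) (j - 1) = quarter (val i) j :=
      quarter_sub_one (not_pow_dvd_iff.2 ⟨hj, h⟩)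
    rw [if_neg h.ne', if_pos h]
    simp [Tile.top, Tile.bottom, axisMark, h1]
  · obtain ⟨o, ho⟩ := exists_eq_pow_mul hj
    have h1 : quarter (val i) j = (2 * o + 1) % 4 := by
      conv_lhs => rw [ho, ← h, quarter_pow_mul_self]
    have h2 : quarter (val i) (j - 1) = (2 * o) % 4 := by
      conv_lhs => rw [ho, ← h, quarter_pow_mul_sub_one]
      simp
    rw [if_pos h.symm]
    simp only [Tile.top, Tile.bottom, axisMark, faces_eq_of_eq ho, h1, h2]
    rcases Int.emod_two_eq_zero_or_one o with h3 | h3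
    · simp [h3, show (2 * o + 1) % 4 = 1 by lia, show (2 * o) % 4 = 0 by lia]
    · simp [h3, show (2 * o + 1) % 4 = 3 by lia, show (2 * o) % 4 = 2 by lia]
  · obtain ⟨m, hm, hiff⟩ := exists_eq_pow_mul_even hj h
    have h1 : quarter (val i) j = (2 * m) % 4 := by rw [hm, quarter_pow_mul_self]
    have h2 : quarter (val i) (j - 1) = (2 * m - 1) % 4 := by rw [hm, quarter_pow_mul_sub_one]
    rw [if_neg h.ne, if_neg h.not_gt]
    by_cases hd : val j = val i + 1
    · have h3 := hiff.1 hd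
      simp [Tile.top, Tile.bottom, axisMark_positive_of_val_eq hi hd, hd]
      simp [axisMark, h1, h2, show (2 * m) % 4 = 2 by lia, show (2 * m - 1) % 4 = 1 by lia]
    · have h3 := mt hiff.2 hd
      simp [Tile.top, Tile.bottom, hd]
      simp [axisMark, h1, h2, show (2 * m) % 4 = 0 by lia, show (2 * m - 1) % 4 = 3 by lia]

theorem cell_top {i j : ℤ} (hi : i ≠ 0) (hj : j ≠ 0) : (cell i j).top = axisMark i j :=
  (cell_top_aux hi hj).1

theorem cell_bottom {i j : ℤ} (hi : i ≠ 0) (hj : j ≠ 0) :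
    (cell i j).bottom = axisMark i (j - 1) :=
  (cell_top_aux hi hj).2

theorem cell_right {i j : ℤ} (hi : i ≠ 0) (hj : j ≠ 0) : (cell i j).right = axisMark j i := by
  rw [← cell_transpose, Tile.transpose_right, cell_top hj hi]

theorem cell_left {i j : ℤ} (hi : i ≠ 0) (hj : j ≠ 0) :
    (cell i j).left = axisMark j (i - 1) := by
  rw [← cell_transpose, Tile.transpose_left, cell_bottom hj hi]

/-! ### Periodicity and self-similarity of the cells. -/

theorem faces_congr {i i' : ℤ} {k : ℕ} (hi : ¬ (2 : ℤ) ^ k ∣ i)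
    (h : (2 : ℤ) ^ (k + 1) ∣ i - i') : faces i = faces i' := by
  have h1 := val_congr hi ((pow_dvd_pow 2 k.le_succ).trans h)
  rw [not_pow_dvd_iff] at hi
  -- The direction is the binary digit after the lowest nonzero one, whence one more power of `2`
  -- than for the order.
  rw [faces, faces, h1.2, quarter_congr (by lia) h]

theorem axisMark_congr {i i' j j' : ℤ} {k : ℕ} (hi : ¬ (2 : ℤ) ^ k ∣ i)
    (h : (2 : ℤ) ^ (k + 1) ∣ i - i') (h' : (2 : ℤ) ^ (k + 1) ∣ j - j') :
    axisMark i j = axisMark i' j' := by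
  have h1 := val_congr hi ((pow_dvd_pow 2 k.le_succ).trans h)
  rw [axisMark, axisMark, ← faces_congr hi h]
  rw [not_pow_dvd_iff] at hi
  rw [h1.2, quarter_congr (by lia) h']

/-- The tiles on the lines of low order are periodic. -/
theorem cell_congr {i i' j j' : ℤ} {k : ℕ} (hi : ¬ (2 : ℤ) ^ k ∣ i) (hj : ¬ (2 : ℤ) ^ k ∣ j)
    (h : (2 : ℤ) ^ (k + 1) ∣ i - i') (h' : (2 : ℤ) ^ (k + 1) ∣ j - j') :
    cell i j = cell i' j' := by
  unfold cell
  rw [axisMark_congr hi h h', axisMark_congr hj h' h, faces_congr hi h, faces_congr hj h',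
    (val_congr hi ((pow_dvd_pow 2 k.le_succ).trans h)).2,
    (val_congr hj ((pow_dvd_pow 2 k.le_succ).trans h')).2]

theorem faces_pow_mul {i : ℤ} (hi : i ≠ 0) (k : ℕ) : faces (2 ^ k * i) = faces i := by
  rw [faces, faces, val_pow_mul hi, quarter_pow_mul]

theorem axisMark_pow_mul_add {i : ℤ} (hi : i ≠ 0) (k : ℕ) (j : ℤ) {q : ℤ} (h0 : 0 ≤ q)
    (hq : q < 2 ^ k) : axisMark (2 ^ k * i) (2 ^ k * j + q) = axisMark i j := by
  rw [axisMark, axisMark, faces_pow_mul hi, val_pow_mul hi, quarter_pow_mul_add _ _ h0 hq]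

theorem cell_pow_mul {i j : ℤ} (hi : i ≠ 0) (hj : j ≠ 0) (k : ℕ) :
    cell (2 ^ k * i) (2 ^ k * j) = cell i j := by
  have h0 : (0 : ℤ) < 2 ^ k := by positivity
  have h1 := axisMark_pow_mul_add hi k j le_rfl h0
  have h2 := axisMark_pow_mul_add hj k i le_rfl h0
  rw [add_zero] at h1 h2
  simp only [cell, val_pow_mul hi, val_pow_mul hj, faces_pow_mul hi, faces_pow_mul hj, h1, h2,
    add_right_inj, add_lt_add_iff_left, add_assoc]

/-- The configuration that is hierarchical off the coordinate axes, with the tile `t` at the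
origin. -/
def blowup (t : Tile) : Config := fun p =>
  if p.1 = 0 then
    if p.2 = 0 then t else (if 0 < p.2 then t.top else t.bottom).vertical
  else if p.2 = 0 then (if 0 < p.1 then t.right else t.left).horizontal
  else cell p.1 p.2

@[simp] theorem EdgeMark.transpose_vertical (m : EdgeMark) :
    m.vertical.transpose = m.horizontal := rfl

@[simp] theorem EdgeMark.transpose_horizontal (m : EdgeMark) :
    m.horizontal.transpose = m.vertical := rfl

theorem blowup_transpose (t : Tile) (i j : ℤ) :
    (blowup t (i, j)).transpose = blowup t.transpose (j, i) := by
  unfold blowup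
  by_cases hi : i = 0 <;> by_cases hj : j = 0
  · simp [hi, hj]
  · by_cases h : 0 < j <;> simp [hi, hj, h]
  · by_cases h : 0 < i <;> simp [hi, hj, h]
  · simp [hi, hj, cell_transpose]

theorem blowup_of_ne {t : Tile} {i j : ℤ} (hi : i ≠ 0) (hj : j ≠ 0) :
    blowup t (i, j) = cell i j := by
  simp [blowup, hi, hj]

theorem not_pow_dvd_of_abs_lt {q : ℤ} {k : ℕ} (hq : q ≠ 0) (h : |q| < 2 ^ k) :
    ¬ (2 : ℤ) ^ k ∣ q := fun hd => hq (Int.eq_zero_of_abs_lt_dvd hd h)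

/-- Near a multiple of a large power of `2`, the rows off the axis have much lower order than the
column. So the column consists of arms with single transverse arrows, and its mark is constant on
each side of the axis. -/
theorem blowup_zero_aux {a b q : ℤ} {k : ℕ} (ha : a ≠ 0) (hb : b ≠ 0) (hq : |q| < 2 ^ k) :
    cell (2 ^ (k + 2) * a) (2 ^ (k + 2) * b + q) = blowup (cell a b) (0, q) := by
  rcases eq_or_ne q 0 with rfl | hq0
  · simp [blowup, cell_pow_mul ha hb]
  have hd := not_pow_dvd_of_abs_lt hq0 hq
  have hv : val (2 ^ (k + 2) * b + q) = val q := by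
    refine (val_congr hd ?_).2
    rw [pow_add, mul_assoc]
    exact ⟨-(2 ^ 2 * b), by ring⟩
  have hk : (2 : ℤ) ^ k < 2 ^ (k + 2) := pow_lt_pow_right₀ (by norm_num) (by lia)
  rw [cell_eq_vertical]
  · rw [abs_lt] at hq
    by_cases hpos : 0 < q
    · rw [axisMark_pow_mul_add ha _ _ hpos.le (by lia)]
      simp [blowup, hq0, hpos, cell_top ha hb]
    · rw [show 2 ^ (k + 2) * b + q = 2 ^ (k + 2) * (b - 1) + (2 ^ (k + 2) + q) by ring,
        axisMark_pow_mul_add ha _ _ (by lia) (by lia)]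
      simp [blowup, hq0, hpos, cell_bottom ha hb]
  · rw [hv, val_pow_mul ha]
    have := (not_pow_dvd_iff.1 hd).2
    lia

/-- Near the multiples of a large power of `2` the hierarchical configuration is the blow-up of the
tile at the quotient. -/
theorem cell_pow_mul_add {a b p q : ℤ} {k : ℕ} (ha : a ≠ 0) (hb : b ≠ 0) (hp : |p| < 2 ^ k)
    (hq : |q| < 2 ^ k) :
    cell (2 ^ (k + 2) * a + p) (2 ^ (k + 2) * b + q) = blowup (cell a b) (p, q) := by
  rcases eq_or_ne p 0 with rfl | hp0
  · rw [add_zero, blowup_zero_aux ha hb hq]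
  rcases eq_or_ne q 0 with rfl | hq0
  · rw [add_zero, ← cell_transpose, blowup_zero_aux hb ha hp, blowup_transpose, cell_transpose]
  rw [blowup_of_ne hp0 hq0]
  refine (cell_congr (not_pow_dvd_of_abs_lt hp0 hp) (not_pow_dvd_of_abs_lt hq0 hq) ?_ ?_).symm
  · exact ⟨-(2 * a), by ring⟩
  · exact ⟨-(2 * b), by ring⟩

/-! ### Occurrence of all tiles. -/

theorem exists_faces_eq (e : Bool) : ∃ o : ℤ, 0 < o ∧ o % 2 = 1 ∧ faces o = e := by
  cases e
  · exact ⟨3, by norm_num, by norm_num, by simp [faces, val_odd, quarter]⟩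
  · exact ⟨1, by norm_num, by norm_num, by simp [faces, val_odd, quarter]⟩

theorem exists_cell_eq_verticalArm (n : Bool) (s : SignType) (d : Bool) :
    ∃ i j : ℤ, 0 < i ∧ 0 < j ∧ cell i j = .verticalArm n s d := by
  obtain ⟨e, he⟩ : ∃ e : Bool, s = 0 ∨ s = axisSign e := by
    cases s
    · exact ⟨true, Or.inl rfl⟩
    · exact ⟨false, Or.inr rfl⟩
    · exact ⟨true, Or.inr rfl⟩
  obtain ⟨o, ho, ho2, hf⟩ := exists_faces_eq e
  -- `m` will be the quarter: its parity gives the direction, and `1`, `2` are the values with a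
  -- side arrow.
  obtain ⟨m, hm0, hm4, hm1, hm2⟩ : ∃ m : ℤ, 0 ≤ m ∧ m < 4 ∧ decide (m % 2 = 1) = n ∧
      (if m = 1 ∨ m = 2 then axisSign e else 0) = s := by
    rcases he with rfl | rfl <;> cases n
    · exact ⟨0, by simp⟩
    · exact ⟨3, by simp⟩
    · exact ⟨2, by simp⟩
    · exact ⟨1, by simp⟩
  -- The row will be odd, so transverse arrows are doubled exactly when the column has order one.
  set k : ℕ := if d then 1 else 2 with hk
  have hk1 : 1 ≤ k := by cases d <;> simp [hk]
  have hk2 : (2 : ℤ) ^ k % 2 = 0 ∧ (1 : ℤ) < 2 ^ k := by cases d <;> simp [hk]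
  have hv : val (2 ^ k * o) = k := by rw [val_pow_mul (by lia), val_odd ho2, add_zero]
  have hv' : val (2 ^ k * m + 1) = 0 := by
    refine val_odd ?_
    rw [Int.add_emod, Int.mul_emod, hk2.1]
    simp
  have hq : quarter k (2 ^ k * m + 1) = m := by
    have := quarter_pow_mul_add (k := k) 0 m (q := 1) (by lia) hk2.2
    rw [add_zero] at this
    rw [this, quarter]
    lia
  refine ⟨2 ^ k * o, 2 ^ k * m + 1, by positivity, by positivity, ?_⟩
  rw [cell, if_neg (by lia), if_pos (by lia), hv, hv', axisMark, hv, hq, faces_pow_mul (by lia), hf]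
  simp only [hm1, hm2]
  cases d <;> simp [hk]

/-- Every tile occurs in the hierarchical configuration. -/
theorem exists_cell_eq (t : Tile) : ∃ i j : ℤ, 0 < i ∧ 0 < j ∧ cell i j = t := by
  cases t with
  | cross e n =>
    obtain ⟨i, hi, hi2, he⟩ := exists_faces_eq e
    obtain ⟨j, hj, hj2, hn⟩ := exists_faces_eq n
    exact ⟨i, j, hi, hj, by rw [cell, if_pos (by rw [val_odd hi2, val_odd hj2]), he, hn]⟩
  | horizontalArm e s d =>
    obtain ⟨i, j, hi, hj, h⟩ := exists_cell_eq_verticalArm e s d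
    exact ⟨j, i, hj, hi, by rw [← cell_transpose, h]; rfl⟩
  | verticalArm n s d => exact exists_cell_eq_verticalArm n s d

end Robinson

namespace Robinson

/-! ### Quadrants contain the hierarchical configuration -/

/-- A matched quadrant with crosses at the positions with odd coordinates. -/
structure Corner (y : Config) : Prop where
  right : ∀ i j, 0 < i → 0 < j → (y (i, j)).right = (y (i + 1, j)).left
  top : ∀ i j, 0 < i → 0 < j → (y (i, j)).top = (y (i, j + 1)).bottom
  cross : ∀ i j, 0 ≤ i → 0 ≤ j → (y (2 * i + 1, 2 * j + 1)).IsCross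

/-- The reflection of a configuration along the diagonal. -/
def reflect (y : Config) : Config := fun p => (y (p.2, p.1)).transpose

theorem Corner.patch {y : Config} (h : Corner y) (k : ℤ) : Patch y k :=
  ⟨fun i j hi _ hj => h.right i j hi hj, fun i j hi _ hj => h.top i j hi hj,
    fun i j hi _ hj => h.cross i j hi hj⟩

theorem Corner.of_patch {y : Config} (h : ∀ k, Patch y k) : Corner y :=
  ⟨fun i j hi hj => (h (i + 1)).right i j hi (by lia) hj,
    fun i j hi hj => (h (i + 1)).top i j hi (by lia) hj,
    fun i j hi hj => (h (i + 1)).cross i j hi (by lia) hj⟩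

theorem Corner.reflect {y : Config} (h : Corner y) : Corner (reflect y) where
  right i j hi hj := by simpa [Robinson.reflect] using h.top j i hj hi
  top i j hi hj := by simpa [Robinson.reflect] using h.right j i hj hi
  cross i j hi hj := by simpa [Robinson.reflect] using h.cross j i hj hi

theorem Corner.translate {y : Config} (h : Corner y) {a b : ℤ} (ha : 0 ≤ a) (hb : 0 ≤ b) :
    Corner (fun p => y (2 * a + p.1, 2 * b + p.2)) :=
  Corner.of_patch fun k => (h.patch (a + k)).translate ha hb le_rfl

/-- At most one pair of neighbouring columns of crosses in a quadrant is not aligned. -/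
theorem Corner.jump_unique {y : Config} (h : Corner y) {i i' : ℤ} (hi : 0 ≤ i) (hii' : i < i')
    (hne : (y (2 * (i + 1) + 1, 1)).facesNorth ≠ (y (2 * i + 1, 1)).facesNorth)
    (hne' : (y (2 * (i' + 1) + 1, 1)).facesNorth ≠ (y (2 * i' + 1, 1)).facesNorth) : False := by
  obtain ⟨J, hJ, hV⟩ := (h.patch (i + 2)).eventually_vertical_of_jump hi (by lia) hne
  obtain ⟨J', hJ', hV'⟩ := (h.patch (i' + 2)).eventually_vertical_of_jump (by lia) (by lia) hne'
  -- High up, the strip between the two columns of vertical arms has outward boundary arrows on both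
  -- sides.
  have h1 := (h.translate (a := i + 1) (b := J + J') (by lia) (by lia)).patch (i' - i)
  refine h1.not_exits (by lia) (fun j hj => ?_) (fun j hj => ?_)
  · have e1 := h.right (2 * i + 2) (2 * (J + J') + j) (by lia) (by lia)
    simp only
    rw [show 2 * (i + 1) + 1 = 2 * i + 2 + 1 by ring, ← e1]
    exact (hV _ (by lia)).right_positive
  · have e1 := h.right (2 * i' + 1) (2 * (J + J') + j) (by lia) (by lia)
    simp only
    rw [show 2 * (i + 1) + (2 * (i' - i) - 1) = 2 * i' + 1 by ring, e1]
    have := hV' (2 * (J + J') + j) (by lia)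
    rw [show 2 * i' + 2 = 2 * i' + 1 + 1 by ring] at this
    exact this.left_positive

/-- There is at most one jump, so the columns to the right of it are all aligned. The first row
suffices by `Patch.facesNorth_eq`. -/
theorem Corner.exists_facesNorth_eq {y : Config} (h : Corner y) :
    ∃ I : ℤ, 0 ≤ I ∧ ∀ i, I ≤ i →
      (y (2 * i + 1, 1)).facesNorth = (y (2 * I + 1, 1)).facesNorth := by
  obtain ⟨I, hI, hc⟩ : ∃ I : ℤ, 0 ≤ I ∧ ∀ i, I ≤ i →
      (y (2 * (i + 1) + 1, 1)).facesNorth = (y (2 * i + 1, 1)).facesNorth := by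
    by_contra! hcon
    obtain ⟨i, hi, hne⟩ := hcon 0 le_rfl
    obtain ⟨i', hi', hne'⟩ := hcon (i + 1) (by lia)
    exact h.jump_unique hi (by lia) hne hne'
  refine ⟨I, hI, fun i hi => ?_⟩
  induction i, hi using Int.leInduction with
  | base => rfl
  | succ i hi ih => rw [hc i hi, ih]

/-- A quadrant in which groups of four crosses face one another. -/
structure AlignedCorner (y : Config) : Prop extends Corner y where
  facesEast : ∀ i j, 0 ≤ i → 0 ≤ j →
    (y (2 * i + 1, 2 * j + 1)).facesEast = decide (i % 2 = 0)
  facesNorth : ∀ i j, 0 ≤ i → 0 ≤ j →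
    (y (2 * i + 1, 2 * j + 1)).facesNorth = decide (j % 2 = 0)

theorem AlignedCorner.reflect {y : Config} (h : AlignedCorner y) :
    AlignedCorner (Robinson.reflect y) where
  toCorner := h.toCorner.reflect
  facesEast i j hi hj := by simpa [Robinson.reflect] using h.facesNorth j i hj hi
  facesNorth i j hi hj := by simpa [Robinson.reflect] using h.facesEast j i hj hi

/-- The columns before the only jump are discarded, and likewise the rows, by reflection. Since
directions alternate, the new corner can be moved by at most one further step in each direction so
that its first cross faces north-east. -/
theorem Corner.exists_aligned {y : Config} (h : Corner y) :
    ∃ a b : ℤ, 0 ≤ a ∧ 0 ≤ b ∧ AlignedCorner (fun p => y (2 * a + p.1, 2 * b + p.2)) := by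
  obtain ⟨I, hI, hN⟩ := h.exists_facesNorth_eq
  obtain ⟨J, hJ, hE⟩ := h.reflect.exists_facesNorth_eq
  simp only [Robinson.reflect, Tile.facesNorth_transpose] at hE
  have hN' : ∀ i j, I ≤ i → 0 ≤ j →
      (y (2 * i + 1, 2 * j + 1)).facesNorth = (y (2 * I + 1, 2 * j + 1)).facesNorth :=
    fun i j hi hj => ((h.patch (i + 1)).facesNorth_eq (by lia) (by lia) hI (by lia) hj).2 (hN i hi)
  have hE' : ∀ i j, 0 ≤ i → J ≤ j →
      (y (2 * i + 1, 2 * j + 1)).facesEast = (y (2 * i + 1, 2 * J + 1)).facesEast :=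
    fun i j hi hj => ((h.patch (i + 1)).facesEast_eq hi (by lia) (by lia) (by lia)).2 (hE j hj)
  have hEs : ∀ i j, 0 ≤ i → 0 ≤ j → (y (2 * (i + 1) + 1, 2 * j + 1)).facesEast =
      !(y (2 * i + 1, 2 * j + 1)).facesEast := fun i j hi hj =>
    ((h.patch (i + 2)).row hi (by lia) hj).1
  have hNs : ∀ i j, 0 ≤ i → 0 ≤ j → (y (2 * i + 1, 2 * (j + 1) + 1)).facesNorth =
      !(y (2 * i + 1, 2 * j + 1)).facesNorth := fun i j hi hj =>
    ((h.patch (i + 2)).column hi (by lia) hj).1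
  obtain ⟨a, ha, hat⟩ : ∃ a, I ≤ a ∧ (y (2 * a + 1, 2 * J + 1)).facesEast = true := by
    by_cases h1 : (y (2 * I + 1, 2 * J + 1)).facesEast = true
    · exact ⟨I, le_rfl, h1⟩
    · exact ⟨I + 1, by lia, by rw [hEs I J hI hJ]; simpa using h1⟩
  obtain ⟨b, hb, hbt⟩ : ∃ b, J ≤ b ∧ (y (2 * I + 1, 2 * b + 1)).facesNorth = true := by
    by_cases h1 : (y (2 * I + 1, 2 * J + 1)).facesNorth = true
    · exact ⟨J, le_rfl, h1⟩
    · exact ⟨J + 1, by lia, by rw [hNs I J hI hJ]; simpa using h1⟩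
  have hEa : ∀ i j, 0 ≤ i → J ≤ j →
      (y (2 * (a + i) + 1, 2 * j + 1)).facesEast = decide (i % 2 = 0) := by
    intro i j hi hj
    induction i, hi using Int.leInduction with
    | base => rw [hE' _ _ (by lia) hj]; simpa using hat
    | succ i hi ih =>
      rw [← add_assoc, hEs _ _ (by lia) (by lia), ih, ← decide_not, decide_eq_decide]
      lia
  have hNb : ∀ i j, I ≤ i → 0 ≤ j →
      (y (2 * i + 1, 2 * (b + j) + 1)).facesNorth = decide (j % 2 = 0) := by
    intro i j hi hj
    induction j, hj using Int.leInduction with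
    | base => rw [hN' _ _ hi (by lia)]; simpa using hbt
    | succ j hj ih =>
      rw [← add_assoc, hNs _ _ (by lia) (by lia), ih, ← decide_not, decide_eq_decide]
      lia
  refine ⟨a, b, by lia, by lia, h.translate (by lia) (by lia), fun i j hi hj => ?_,
    fun i j hi hj => ?_⟩
  · have := hEa i (b + j) hi (by lia)
    simp only
    rw [← this]
    congr 3 <;> ring
  · have := hNb (a + i) j (by lia) hj
    simp only
    rw [← this]
    congr 3 <;> ring

theorem AlignedCorner.coarsen {y : Config} (h : AlignedCorner y) :
    Corner (fun p => y (2 * p.1, 2 * p.2)) := by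
  refine Corner.of_patch fun k => ?_
  have := (h.patch (2 * k)).coarsen (k' := k) (b := 0) le_rfl le_rfl
    (fun i j hi _ hj => by rw [h.facesEast _ _ (by lia) (by lia)]; simp)
    (fun i j hi _ hj => by rw [h.facesNorth _ _ (by lia) (by lia)]; simp)
  simpa using this

/-! ### From the pattern at even positions to the whole pattern. -/

section Refine

variable {y : Config} (h : AlignedCorner y) {a b : ℤ} (ha : 0 ≤ a) (hb : 0 ≤ b)

theorem faces_two_mul_add_one (o : ℤ) : faces (2 * o + 1) = decide (o % 2 = 0) := by
  rw [faces_eq_of_eq (o := o)]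
  rw [val_odd (by lia)]
  ring

theorem cell_odd_odd (p q : ℤ) :
    cell (2 * p + 1) (2 * q + 1) = .cross (decide (p % 2 = 0)) (decide (q % 2 = 0)) := by
  rw [cell, if_pos (by rw [val_odd (by lia), val_odd (by lia)]), faces_two_mul_add_one,
    faces_two_mul_add_one]

include h ha hb

theorem AlignedCorner.odd_odd {p q : ℤ} (hp : 0 ≤ p) (hq : 0 ≤ q) :
    y (4 * a + (2 * p + 1), 4 * b + (2 * q + 1)) = cell (2 * p + 1) (2 * q + 1) := by
  rw [show 4 * a + (2 * p + 1) = 2 * (2 * a + p) + 1 by ring,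
    show 4 * b + (2 * q + 1) = 2 * (2 * b + q) + 1 by ring, cell_odd_odd,
    (h.cross (2 * a + p) (2 * b + q) (by lia) (by lia)).eq,
    h.facesEast _ _ (by lia) (by lia), h.facesNorth _ _ (by lia) (by lia)]
  simp

/-- The crosses above and below supply two marks, the known tile on the left the third. In the first
column no tile on the left is known; there the tile is a horizontal arm, and its left mark is read
off on the right. -/
theorem AlignedCorner.odd_even {N : ℕ} (hc : ∀ p q, 0 < p → p < 2 ^ N → 0 < q → q < 2 ^ N →
      y (4 * a + 2 * p, 4 * b + 2 * q) = cell p q) {p q : ℤ} (hp : 0 ≤ p) (hpN : p < 2 ^ N)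
    (hq : 0 < q) (hqN : q < 2 ^ N) :
    y (4 * a + (2 * p + 1), 4 * b + 2 * q) = cell (2 * p + 1) (2 * q) := by
  have hc' : ∀ p q, 0 < p → p < 2 ^ N → 0 < q → q < 2 ^ N →
      y (4 * a + 2 * p, 4 * b + 2 * q) = cell (2 * p) (2 * q) := by
    intro p q h1 h2 h3 h4
    rw [hc p q h1 h2 h3 h4]
    simpa using (cell_pow_mul (i := p) (j := q) (by lia) (by lia) 1).symm
  have ht : (y (4 * a + (2 * p + 1), 4 * b + 2 * q)).top = (cell (2 * p + 1) (2 * q)).top := by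
    rw [h.top _ _ (by lia) (by lia), add_assoc, h.odd_odd ha hb hp hq.le,
      cell_bottom (by lia) (by lia), cell_top (by lia) (by lia), add_sub_cancel_right]
  have hbo : (y (4 * a + (2 * p + 1), 4 * b + 2 * q)).bottom =
      (cell (2 * p + 1) (2 * q)).bottom := by
    have h1 := h.top (4 * a + (2 * p + 1)) (4 * b + (2 * (q - 1) + 1)) (by lia) (by lia)
    rw [h.odd_odd ha hb hp (by lia), cell_top (by lia) (by lia)] at h1
    rw [cell_bottom (by lia) (by lia), show 2 * q - 1 = 2 * (q - 1) + 1 by ring, h1]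
    congr 3
    ring
  refine Tile.eq_of_marks ?_ ht hbo
  rcases hp.eq_or_lt with rfl | hp
  · have h1 := h.right (4 * a + (2 * 0 + 1)) (4 * b + 2 * q) (by lia) (by lia)
    rw [show 4 * a + (2 * 0 + 1) + 1 = 4 * a + 2 * 1 by ring, hc' 1 q (by lia) (by lia) hq hqN,
      cell_left (by lia) (by lia), show (2 : ℤ) * 1 - 1 = 2 * 0 + 1 by ring,
      ← cell_right (by lia) (by lia)] at h1
    have h2 := ((h.patch (2 * a + 1)).column (i := 2 * a) (j := 2 * b + q - 1) (by lia) (by lia)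
      (by lia)).2.2.1
    rw [show 2 * (2 * a) + 1 = 4 * a + (2 * 0 + 1) by ring,
      show 2 * (2 * b + q - 1) + 2 = 4 * b + 2 * q by ring] at h2
    rw [← Tile.right_eq_left_of_transpose h2, h1]
    refine Tile.right_eq_left_of_transpose ?_
    have h3 : val (2 * q) = 1 + val q := by simpa using val_pow_mul (i := q) (by lia) 1
    have h4 : val (2 * 0 + 1) = 0 := val_odd (by lia)
    rw [cell_transpose, cell, if_neg (by lia), if_pos (by lia)]
    exact ⟨_, _, _, rfl⟩
  · have h1 := h.right (4 * a + 2 * p) (4 * b + 2 * q) (by lia) (by lia)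
    rw [hc' p q hp hpN hq hqN, cell_right (by lia) (by lia), add_assoc] at h1
    rw [← h1, cell_left (by lia) (by lia), add_sub_cancel_right]

/-- Positions with two even coordinates use the self-similarity of `cell`; the two mixed parities
are exchanged by the reflection. -/
theorem AlignedCorner.refine {N : ℕ} (hc : ∀ p q, 0 < p → p < 2 ^ N → 0 < q → q < 2 ^ N →
      y (4 * a + 2 * p, 4 * b + 2 * q) = cell p q) {p q : ℤ} (hp : 0 < p) (hpN : p < 2 ^ (N + 1))
    (hq : 0 < q) (hqN : q < 2 ^ (N + 1)) :
    y (4 * a + p, 4 * b + q) = cell p q := by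
  rw [pow_succ] at hpN hqN
  obtain ⟨p', rfl | rfl⟩ : ∃ p', p = 2 * p' + 1 ∨ p = 2 * p' := ⟨p / 2, by lia⟩ <;>
    obtain ⟨q', rfl | rfl⟩ : ∃ q', q = 2 * q' + 1 ∨ q = 2 * q' := ⟨q / 2, by lia⟩
  · exact h.odd_odd ha hb (by lia) (by lia)
  · exact h.odd_even ha hb hc (by lia) (by lia) (by lia) (by lia)
  · have := h.reflect.odd_even (N := N) (a := b) (b := a) hb ha (fun p q h1 h2 h3 h4 => by
      simp only [Robinson.reflect]
      rw [hc q p h3 h4 h1 h2, cell_transpose]) (p := q') (q := p') (by lia) (by lia) (by lia)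
      (by lia)
    simp only [Robinson.reflect] at this
    rw [← cell_transpose, ← this, Tile.transpose_transpose]
  · rw [hc p' q' (by lia) (by lia) (by lia) (by lia)]
    simpa using (cell_pow_mul (i := p') (j := q') (by lia) (by lia) 1).symm

end Refine

/-- Induction on the scale: the centres of an aligned corner form a corner, a square of half the
size is found there, and the crosses at odd positions determine the remaining tiles. -/
theorem Corner.exists_eq_cell {y : Config} (h : Corner y) (N : ℕ) :
    ∃ a b : ℤ, 0 ≤ a ∧ 0 ≤ b ∧ ∀ p q, 0 < p → p < 2 ^ N → 0 < q → q < 2 ^ N →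
      y (2 * a + p, 2 * b + q) = cell p q := by
  induction N generalizing y with
  | zero => exact ⟨0, 0, le_rfl, le_rfl, fun p q h1 h2 => by simp at h2; lia⟩
  | succ N ih =>
    obtain ⟨a, b, ha, hb, h1⟩ := h.exists_aligned
    obtain ⟨a', b', ha', hb', h2⟩ := ih h1.coarsen
    refine ⟨a + 2 * a', b + 2 * b', by lia, by lia, fun p q hp hpN hq hqN => ?_⟩
    have := h1.refine ha' hb' (N := N) (fun p q h3 h4 h5 h6 => by
      rw [← h2 p q h3 h4 h5 h6]
      simp only
      congr 2 <;> ring) hp hpN hq hqN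
    simp only at this
    rw [← this]
    congr 2 <;> ring

/-- Every configuration of the Robinson shift contains all squares of the hierarchical
configuration. -/
theorem exists_eq_cell_of_mem {y : Config} (hy : y ∈ robinsonShift) (N : ℕ) :
    ∃ c : ℤ × ℤ, ∀ p : ℤ × ℤ, 0 < p.1 → p.1 < 2 ^ N → 0 < p.2 → p.2 < 2 ^ N →
      y (p + c) = cell p.1 p.2 := by
  obtain ⟨hr, ht, a, b, hc⟩ := hy
  -- The translation moves the given crosses to the positions with odd coordinates.
  have h : Corner (fun p => y (a - 1 + p.1, b - 1 + p.2)) := by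
    refine ⟨fun i j _ _ => ?_, fun i j _ _ => ?_, fun i j _ _ => ?_⟩
    · simpa [add_assoc] using hr (a - 1 + i) (b - 1 + j)
    · simpa [add_assoc] using ht (a - 1 + i) (b - 1 + j)
    · have := hc i j
      simp only
      convert this using 3 <;> ring
  obtain ⟨a', b', -, -, h'⟩ := h.exists_eq_cell N
  refine ⟨(a - 1 + 2 * a', b - 1 + 2 * b'), fun p h1 h2 h3 h4 => ?_⟩
  rw [← h' p.1 p.2 h1 h2 h3 h4]
  simp only
  congr 1
  ext <;> simp <;> ring

end Robinson

namespace Robinson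

open Topology

/-! ### The topology of the full shift -/

/-- The square of radius `R` around the origin. -/
def box (R : ℤ) : Set (ℤ × ℤ) := {p | |p.1| ≤ R ∧ |p.2| ≤ R}

theorem box_mono {R R' : ℤ} (h : R ≤ R') : box R ⊆ box R' := fun _ hp =>
  ⟨hp.1.trans h, hp.2.trans h⟩

theorem finite_box (R : ℤ) : (box R).Finite := by
  refine (Set.finite_Icc ((-R, -R) : ℤ × ℤ) (R, R)).subset fun p hp => ?_
  simp only [box, Set.mem_ofPred_eq, abs_le] at hp
  exact ⟨⟨hp.1.1, hp.2.1⟩, ⟨hp.1.2, hp.2.2⟩⟩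

theorem mem_box_self (p : ℤ × ℤ) : p ∈ box (|p.1| + |p.2|) :=
  ⟨by simp, by simp⟩

theorem zero_mem_box : (0 : ℤ × ℤ) ∈ box 0 := by simp [box]

theorem eqOn_box_mem_nhds (x : Config) (R : ℤ) : {y | Set.EqOn y x (box R)} ∈ 𝓝 x := by
  have : {y : Config | Set.EqOn y x (box R)} = (box R).pi fun p => {x p} := by
    ext y
    simp [Set.EqOn, Set.pi]
  rw [this]
  exact set_pi_mem_nhds (finite_box R) fun p _ => by simp

theorem exists_box_subset {x : Config} {U : Set Config} (hU : U ∈ 𝓝 x) :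
    ∃ R : ℤ, 0 ≤ R ∧ ∀ y : Config, Set.EqOn y x (box R) → y ∈ U := by
  obtain ⟨V, hVU, hV, hxV⟩ := mem_nhds_iff.1 hU
  obtain ⟨I, u, hu, hI⟩ := isOpen_pi_iff.1 hV x hxV
  refine ⟨∑ p ∈ I, (|p.1| + |p.2|), Finset.sum_nonneg fun p _ => by positivity,
    fun y hy => hVU (hI fun p hp => ?_)⟩
  have hp' : p ∈ box (∑ p ∈ I, (|p.1| + |p.2|)) :=
    box_mono (Finset.single_le_sum (f := fun p : ℤ × ℤ => |p.1| + |p.2|)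
      (fun p _ => by positivity) hp) (mem_box_self p)
  rw [hy hp']
  exact (hu p hp).2

theorem mem_of_forall_box {Z : Set Config} (hZ : IsClosed Z) {x : Config}
    (h : ∀ R : ℤ, ∃ y ∈ Z, Set.EqOn y x (box R)) : x ∈ Z := by
  rw [← hZ.closure_eq, mem_closure_iff_nhds]
  intro U hU
  obtain ⟨R, -, hR⟩ := exists_box_subset hU
  obtain ⟨y, hy, hyx⟩ := h R
  exact ⟨y, hR y hyx, hy⟩

@[simp] theorem shift_apply (v : ℤ × ℤ) (x : Config) (p : ℤ × ℤ) : shift v x p = x (p + v) := rfl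

theorem shift_shift (v w : ℤ × ℤ) (x : Config) : shift v (shift w x) = shift (v + w) x := by
  funext p
  simp [add_assoc]

@[simp] theorem shift_zero (x : Config) : shift 0 x = x := by
  funext p
  simp

theorem shift_symm_apply (v : ℤ × ℤ) (x : Config) : (shift v).symm x = shift (-v) x := by
  funext p
  simp [shift, sub_eq_add_neg]

theorem IsSubshift.coe_σ₁_zpow {X : Set Config} (h : IsSubshift X) (n : ℤ) (x : X) :
    ((h.σ₁ ^ n) x : Config) = shift (n, 0) x := by
  have h1 : ∀ x : X, (h.σ₁ x : Config) = shift (1, 0) x := fun _ => rfl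
  have h2 : ∀ x : X, (h.σ₁⁻¹ x : Config) = shift (-1, 0) x := fun x =>
    shift_symm_apply (1, 0) x
  induction n using Int.induction_on generalizing x with
  | zero => exact (shift_zero _).symm
  | succ n ih =>
    rw [zpow_add_one, Homeomorph.mul_apply, ih, h1, shift_shift]
    simp
  | pred n ih =>
    rw [zpow_sub_one, Homeomorph.mul_apply, ih, h2, shift_shift]
    simp [sub_eq_add_neg]

theorem IsSubshift.coe_σ₂_zpow {X : Set Config} (h : IsSubshift X) (n : ℤ) (x : X) :
    ((h.σ₂ ^ n) x : Config) = shift (0, n) x := by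
  have h1 : ∀ x : X, (h.σ₂ x : Config) = shift (0, 1) x := fun _ => rfl
  have h2 : ∀ x : X, (h.σ₂⁻¹ x : Config) = shift (0, -1) x := fun x =>
    shift_symm_apply (0, 1) x
  induction n using Int.induction_on generalizing x with
  | zero => exact (shift_zero _).symm
  | succ n ih =>
    rw [zpow_add_one, Homeomorph.mul_apply, ih, h1, shift_shift]
    simp
  | pred n ih =>
    rw [zpow_sub_one, Homeomorph.mul_apply, ih, h2, shift_shift]
    simp [sub_eq_add_neg]

theorem IsSubshift.coe_mul_zpow {X : Set Config} (h : IsSubshift X) (v : ℤ × ℤ) (x : X) :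
    ((h.σ₁ ^ v.1 * h.σ₂ ^ v.2) x : Config) = shift v x := by
  rw [Homeomorph.mul_apply, h.coe_σ₁_zpow, h.coe_σ₂_zpow, shift_shift]
  simp

theorem IsSubshift.shift_mem {X : Set Config} (h : IsSubshift X) (v : ℤ × ℤ) {x : Config}
    (hx : x ∈ X) : shift v x ∈ X := by
  rw [← h.coe_mul_zpow v ⟨x, hx⟩]
  exact Subtype.coe_prop _

theorem mul_zpow_mem_actingGroup {X : Type*} [TopologicalSpace X] (S T : X ≃ₜ X) (n m : ℤ) :
    S ^ n * T ^ m ∈ CubeSystem.actingGroup S T :=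
  mul_mem (zpow_mem (Subgroup.subset_closure (by simp)) n)
    (zpow_mem (Subgroup.subset_closure (by simp)) m)

theorem IsSubshift.σ₁_mul_σ₂ {X : Set Config} (h : IsSubshift X) : h.σ₁ * h.σ₂ = h.σ₂ * h.σ₁ := by
  refine Homeomorph.ext fun x => Subtype.ext ?_
  have h1 : ∀ x : X, (h.σ₁ x : Config) = shift (1, 0) x := fun _ => rfl
  have h2 : ∀ x : X, (h.σ₂ x : Config) = shift (0, 1) x := fun _ => rfl
  rw [Homeomorph.mul_apply, Homeomorph.mul_apply, h1, h2, h2, h1, shift_shift, shift_shift,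
    add_comm]

/-! ### The minimal Robinson system -/

/-- On the square of radius `R` the configuration `x` is the pattern of the hierarchical
configuration around the position `c`. -/
def Occurs (R : ℤ) (x : Config) (c : ℤ × ℤ) : Prop :=
  ∀ p ∈ box R, 0 < p.1 + c.1 ∧ 0 < p.2 + c.2 ∧ x p = cell (p.1 + c.1) (p.2 + c.2)

/-- The configurations all of whose patterns occur in the positive quadrant of the hierarchical
configuration. -/
def minimalShift : Set Config := {x | ∀ R : ℤ, ∃ c : ℤ × ℤ, Occurs R x c}

theorem Occurs.mono {R R' : ℤ} {x : Config} {c : ℤ × ℤ} (h : Occurs R' x c) (hR : R ≤ R') :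
    Occurs R x c := fun p hp => h p (box_mono hR hp)

theorem Occurs.congr {R : ℤ} {x y : Config} {c : ℤ × ℤ} (h : Occurs R x c)
    (hxy : Set.EqOn y x (box R)) : Occurs R y c := fun p hp => by
  rw [hxy hp]
  exact h p hp

theorem Occurs.eq {R : ℤ} {x : Config} {c : ℤ × ℤ} (h : Occurs R x c) {i j : ℤ}
    (hi : |i| ≤ R) (hj : |j| ≤ R) : x (i, j) = cell (i + c.1) (j + c.2) :=
  (h (i, j) ⟨hi, hj⟩).2.2

theorem Occurs.shift {R : ℤ} {x : Config} {c v : ℤ × ℤ}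
    (h : Occurs (R + (|v.1| + |v.2|)) x c) : Occurs R (shift v x) (c + v) := fun p hp => by
  have hp1 := abs_add_le p.1 v.1
  have hp2 := abs_add_le p.2 v.2
  have h1 := abs_nonneg v.1
  have h2 := abs_nonneg v.2
  obtain ⟨hp3, hp4⟩ := hp
  have := h (p + v) ⟨by simp only [Prod.fst_add]; lia, by simp only [Prod.snd_add]; lia⟩
  simpa [add_assoc, add_comm v.1, add_comm v.2] using this

theorem shift_mem_minimalShift (v : ℤ × ℤ) {x : Config} (hx : x ∈ minimalShift) :
    shift v x ∈ minimalShift := fun R => by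
  obtain ⟨c, hc⟩ := hx (R + (|v.1| + |v.2|))
  exact ⟨_, hc.shift⟩

theorem shift_mem_minimalShift_iff (v : ℤ × ℤ) {x : Config} :
    shift v x ∈ minimalShift ↔ x ∈ minimalShift := by
  refine ⟨fun h => ?_, shift_mem_minimalShift v⟩
  have := shift_mem_minimalShift (-v) h
  rwa [shift_shift, neg_add_cancel, shift_zero] at this

theorem isClosed_minimalShift : IsClosed minimalShift := by
  refine isClosed_of_closure_subset fun x hx R => ?_
  obtain ⟨y, hy, hyX⟩ := mem_closure_iff_nhds.1 hx _ (eqOn_box_mem_nhds x R)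
  obtain ⟨c, hc⟩ := hyX R
  exact ⟨c, hc.congr fun p hp => (hy hp).symm⟩

theorem isSubshift_minimalShift : IsSubshift minimalShift :=
  ⟨isClosed_minimalShift, fun _ => (shift_mem_minimalShift_iff _).symm,
    fun _ => (shift_mem_minimalShift_iff _).symm⟩

theorem exists_lt_two_pow (R : ℤ) : ∃ k : ℕ, R < 2 ^ k := by
  refine ⟨R.toNat, ?_⟩
  have : R.toNat < 2 ^ R.toNat := Nat.lt_two_pow_self
  have h2 : ((R.toNat : ℕ) : ℤ) < 2 ^ R.toNat := by exact_mod_cast this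
  lia

theorem occurs_blowup {a b : ℤ} (ha : 0 < a) (hb : 0 < b) {R : ℤ} {k : ℕ} (hR : R < 2 ^ k) :
    Occurs R (blowup (cell a b)) (2 ^ (k + 2) * a, 2 ^ (k + 2) * b) := fun p hp => by
  obtain ⟨h1, h2⟩ := hp
  have h3 : (2 : ℤ) ^ k < 2 ^ (k + 2) := pow_lt_pow_right₀ (by norm_num) (by lia)
  have h4 : (2 : ℤ) ^ (k + 2) * 1 ≤ 2 ^ (k + 2) * a := by gcongr; lia
  have h5 : (2 : ℤ) ^ (k + 2) * 1 ≤ 2 ^ (k + 2) * b := by gcongr; lia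
  rw [abs_le] at h1 h2
  refine ⟨by simp only; lia, by simp only; lia, ?_⟩
  simp only
  rw [add_comm p.1, add_comm p.2, cell_pow_mul_add ha.ne' hb.ne' (by rw [abs_lt]; lia)
    (by rw [abs_lt]; lia)]

/-- Every tile is some `cell a b`, and its blow-up is seen around large multiples of `(a, b)`. -/
theorem blowup_mem_minimalShift (t : Tile) : blowup t ∈ minimalShift := fun R => by
  obtain ⟨a, b, ha, hb, rfl⟩ := exists_cell_eq t
  obtain ⟨k, hk⟩ := exists_lt_two_pow R
  exact ⟨_, occurs_blowup ha hb hk⟩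

/-- Serves both minimality and uniqueness: a pattern of `y` lies in a finite square of the positive
quadrant of `cell`, and `x` contains that square. -/
theorem exists_shift_eqOn {x y : Config} (hx : x ∈ robinsonShift) (hy : y ∈ minimalShift) (R : ℤ) :
    ∃ v : ℤ × ℤ, Set.EqOn (shift v x) y (box R) := by
  obtain ⟨c, hc⟩ := hy R
  obtain ⟨N, hN⟩ := exists_lt_two_pow (R + |c.1| + |c.2|)
  obtain ⟨d, hd⟩ := exists_eq_cell_of_mem hx N
  refine ⟨c + d, fun p hp => ?_⟩
  obtain ⟨h1, h2, h3⟩ := hc p hp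
  obtain ⟨h4, h5⟩ := hp
  rw [abs_le] at h4 h5
  have h6 := le_abs_self c.1
  have h7 := le_abs_self c.2
  have h8 := abs_nonneg c.1
  have h9 := abs_nonneg c.2
  rw [h3, shift_apply, ← add_assoc, hd _ h1 (by simp only [Prod.fst_add]; lia) h2
    (by simp only [Prod.snd_add]; lia)]
  rfl

theorem minimalShift_subset_of_isSubshift {X : Set Config} (hX : IsSubshift X)
    (hXY : X ⊆ robinsonShift) (hne : X.Nonempty) : minimalShift ⊆ X := fun y hy => by
  obtain ⟨x, hx⟩ := hne
  refine mem_of_forall_box hX.isClosed fun R => ?_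
  obtain ⟨v, hv⟩ := exists_shift_eqOn (hXY hx) hy R
  exact ⟨_, hX.shift_mem v hx, hv⟩

/-- Of two consecutive even integers exactly one is divisible by `4`, so their orders differ. Hence
crosses at distance two detect odd coordinates. -/
theorem val_eq_zero_of_val_add_two {i j : ℤ} (hi : i ≠ 0) (hi2 : i + 2 ≠ 0)
    (h1 : val i = val j) (h2 : val (i + 2) = val j) : i % 2 = 1 := by
  by_contra h
  have h3 : 1 ≤ val i := (pow_dvd_iff hi).1 (by rw [pow_one]; lia)
  have h4 : ¬ (2 ≤ val i) := fun h5 => by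
    have h6 := (pow_dvd_iff hi).2 h5
    have h7 := (pow_dvd_iff hi2 (k := 2)).2 (by lia)
    lia
  have h6 := (not_congr (pow_dvd_iff hi)).2 h4
  have h7 := (not_congr (pow_dvd_iff hi2 (k := 2))).2 (by lia)
  lia

theorem minimalShift_subset : minimalShift ⊆ robinsonShift := fun x hx => by
  refine ⟨fun i j => ?_, fun i j => ?_, ?_⟩
  · obtain ⟨c, hc⟩ := hx (|i| + |j| + 1)
    have h1 := hc (i, j) ⟨by grind, by grind⟩
    have h2 := hc (i + 1, j) ⟨by grind, by grind⟩
    simp only at h1 h2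
    rw [h1.2.2, h2.2.2, cell_right (by lia) (by lia), cell_left (by lia) (by lia)]
    congr 1
    ring
  · obtain ⟨c, hc⟩ := hx (|i| + |j| + 1)
    have h1 := hc (i, j) ⟨by grind, by grind⟩
    have h2 := hc (i, j + 1) ⟨by grind, by grind⟩
    simp only at h1 h2
    rw [h1.2.2, h2.2.2, cell_top (by lia) (by lia), cell_bottom (by lia) (by lia)]
    congr 1
    ring
  · obtain ⟨c, hc⟩ := hx 3
    obtain ⟨a, ha, ha0, ha1⟩ : ∃ a : ℤ, (a + c.1) % 2 = 1 ∧ 0 ≤ a ∧ a ≤ 1 := by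
      rcases Int.emod_two_eq_zero_or_one c.1 with h | h
      · exact ⟨1, by lia, by lia, by lia⟩
      · exact ⟨0, by lia, by lia, by lia⟩
    obtain ⟨b, hb, hb0, hb1⟩ : ∃ b : ℤ, (b + c.2) % 2 = 1 ∧ 0 ≤ b ∧ b ≤ 1 := by
      rcases Int.emod_two_eq_zero_or_one c.2 with h | h
      · exact ⟨1, by lia, by lia, by lia⟩
      · exact ⟨0, by lia, by lia, by lia⟩
    have h1 : (x (a, b)).IsCross := by
      rw [hc.eq (by grind) (by grind), isCross_cell, val_odd ha, val_odd hb]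
    have h2 : (x (a + 2, b)).IsCross := by
      rw [hc.eq (by grind) (by grind), isCross_cell, val_odd (by lia),
        val_odd hb]
    have h3 : (x (a, b + 2)).IsCross := by
      rw [hc.eq (by grind) (by grind), isCross_cell, val_odd ha,
        val_odd (by lia)]
    refine ⟨a, b, fun i j => ?_⟩
    -- The position `d` is unrelated to `c`; the three crosses found above fix its parity.
    obtain ⟨d, hd⟩ := hx (3 + 2 * |i| + 2 * |j|)
    have h0 := hd (a, b) ⟨by grind, by grind⟩
    have h0' := hd (a + 2, b) ⟨by grind, by grind⟩
    have h0'' := hd (a, b + 2) ⟨by grind, by grind⟩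
    rw [h0.2.2, isCross_cell] at h1
    rw [h0'.2.2, isCross_cell] at h2
    rw [h0''.2.2, isCross_cell] at h3
    simp only at h0 h0' h0'' h1 h2 h3
    have e1 := val_eq_zero_of_val_add_two (i := a + d.1) (j := b + d.2) (by lia) (by lia) h1
      (by rw [← h2]; congr 1; ring)
    have e2 := val_eq_zero_of_val_add_two (i := b + d.2) (j := a + d.1) (by lia) (by lia) h1.symm
      (by rw [h3]; congr 1; ring)
    rw [hd.eq (by grind) (by grind), isCross_cell, val_odd (by lia),
      val_odd (by lia)]

theorem isMinimalSubsystem_minimalShift : IsMinimalSubsystem robinsonShift minimalShift where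
  subset := minimalShift_subset
  nonempty := ⟨_, blowup_mem_minimalShift (.cross true true)⟩
  isSubshift := isSubshift_minimalShift
  isMinimal x y := by
    rw [closure_subtype, mem_closure_iff_nhds]
    intro U hU
    obtain ⟨R, -, hR⟩ := exists_box_subset hU
    obtain ⟨v, hv⟩ := exists_shift_eqOn (minimalShift_subset x.2) y.2 R
    refine ⟨shift v x, hR _ hv, ⟨_, shift_mem_minimalShift v x.2⟩, ?_, rfl⟩
    exact ⟨_, mul_zpow_mem_actingGroup _ _ v.1 v.2,
      Subtype.ext (isSubshift_minimalShift.coe_mul_zpow v x).symm⟩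

/-- `minimalShift` is closed and invariant, and it contains a point whose orbit is dense in `X`. -/
theorem eq_minimalShift {X : Set Config} (hX : IsMinimalSubsystem robinsonShift X) :
    X = minimalShift := by
  have hsub := minimalShift_subset_of_isSubshift hX.isSubshift hX.subset hX.nonempty
  refine subset_antisymm (fun x hx => ?_) hsub
  have h0 := blowup_mem_minimalShift (.cross true true)
  have hd := hX.isMinimal ⟨_, hsub h0⟩ ⟨x, hx⟩
  rw [closure_subtype] at hd
  refine closure_minimal ?_ isClosed_minimalShift hd
  rintro _ ⟨_, ⟨g, hg, rfl⟩, rfl⟩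
  have key : ∀ z : X, (z : Config) ∈ minimalShift ↔ (g z : Config) ∈ minimalShift := by
    induction hg using Subgroup.closure_induction with
    | mem g hg =>
      rcases hg with rfl | rfl
      · exact fun z => (shift_mem_minimalShift_iff (1, 0)).symm
      · exact fun z => (shift_mem_minimalShift_iff (0, 1)).symm
    | one => exact fun z => Iff.rfl
    | mul g g' _ _ h h' => exact fun z => (h' z).trans (h (g' z))
    | inv g _ h =>
      intro z
      rw [h (g⁻¹ z), ← Homeomorph.mul_apply, mul_inv_cancel]
      rfl
  exact (key _).1 h0

end Robinson

namespace Robinson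

open Topology CubeSystem

/-! ### Fault lines -/

@[simp] theorem reflect_reflect (x : Config) : reflect (reflect x) = x := by
  funext p
  simp [reflect]

theorem isVerticalFaultLine_reflect {x : Config} {i : ℤ} :
    IsVerticalFaultLine (reflect x) i ↔ IsHorizontalFaultLine x i := by
  simp [IsVerticalFaultLine, IsHorizontalFaultLine, reflect]

theorem isHorizontalFaultLine_reflect {x : Config} {j : ℤ} :
    IsHorizontalFaultLine (reflect x) j ↔ IsVerticalFaultLine x j := by
  simp [IsVerticalFaultLine, IsHorizontalFaultLine, reflect]

theorem Occurs.reflect {R : ℤ} {x : Config} {c : ℤ × ℤ} (h : Occurs R x c) :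
    Occurs R (reflect x) c.swap := fun p hp => by
  obtain ⟨h1, h2, h3⟩ := h p.swap ⟨hp.2, hp.1⟩
  refine ⟨h2, h1, ?_⟩
  rw [Robinson.reflect, ← cell_transpose]
  exact congrArg _ h3

theorem reflect_mem_minimalShift {x : Config} (hx : x ∈ minimalShift) :
    reflect x ∈ minimalShift := fun R => by
  obtain ⟨c, hc⟩ := hx R
  exact ⟨_, hc.reflect⟩

theorem exists_val_add_eq (a : ℤ) (k : ℕ) : ∃ p : ℤ, 0 ≤ p ∧ p < 2 ^ (k + 1) ∧ val (p + a) = k := by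
  refine ⟨(2 ^ k - a) % 2 ^ (k + 1), Int.emod_nonneg _ (by positivity),
    Int.emod_lt_of_pos _ (by positivity), ?_⟩
  have h := Int.mul_ediv_add_emod (2 ^ k - a) (2 ^ (k + 1))
  set d := (2 ^ k - a) / 2 ^ (k + 1)
  rw [show (2 ^ k - a) % 2 ^ (k + 1) + a = 2 ^ k * (2 * (-d) + 1) by rw [pow_succ] at h ⊢; lia,
    val_pow_mul (by lia), val_odd (by lia), add_zero]

/-- On a column of order at least `k` the ordinates of two crosses have this order too, so the
crosses are at least `2 ^ k` apart. -/
theorem not_pow_dvd_of_isCross {R : ℤ} {x : Config} {c : ℤ × ℤ} (h : Occurs R x c) {i j j' : ℤ}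
    (hi : |i| ≤ R) (hj : |j| ≤ R) (hj' : |j'| ≤ R) (hne : j ≠ j') (hx : (x (i, j)).IsCross)
    (hx' : (x (i, j')).IsCross) {k : ℕ} (hk : 2 * R < 2 ^ k) : ¬ (2 : ℤ) ^ k ∣ i + c.1 := by
  have h1 := h (i, j) ⟨hi, hj⟩
  have h2 := h (i, j') ⟨hi, hj'⟩
  rw [h1.2.2, isCross_cell] at hx
  rw [h2.2.2, isCross_cell] at hx'
  simp only at h1 h2 hx hx'
  intro hd
  rw [pow_dvd_iff (by lia)] at hd
  have h3 := (pow_dvd_iff (i := j + c.2) (k := k) (by lia)).2 (by lia)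
  have h4 := (pow_dvd_iff (i := j' + c.2) (k := k) (by lia)).2 (by lia)
  have h5 := dvd_sub h3 h4
  exact not_pow_dvd_of_abs_lt (q := j + c.2 - (j' + c.2)) (by lia) (by grind) h5

theorem exists_not_pow_dvd {x : Config} {i : ℤ} (h : ¬ IsVerticalFaultLine x i) :
    ∃ (k : ℕ) (R : ℤ), ∀ c, Occurs R x c → ¬ (2 : ℤ) ^ k ∣ i + c.1 := by
  rw [IsVerticalFaultLine, Set.not_subsingleton_iff] at h
  obtain ⟨j, hj, j', hj', hne⟩ := h
  obtain ⟨k, hk⟩ := exists_lt_two_pow (2 * (|i| + |j| + |j'|))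
  exact ⟨k, |i| + |j| + |j'|, fun c hc =>
    not_pow_dvd_of_isCross hc (by grind) (by grind) (by grind) hne hj hj' hk⟩

/-- On a column of order `v` crosses recur with period `2 ^ (v + 1)`. If `v < k`, two of them lie in
the window, so the column is not a fault line. -/
theorem exists_pow_dvd {x : Config} {i : ℤ} (h : IsVerticalFaultLine x i) (k : ℕ) :
    ∃ R : ℤ, ∀ c, Occurs R x c → (2 : ℤ) ^ k ∣ i + c.1 := by
  refine ⟨|i| + 2 ^ (k + 2), fun c hc => ?_⟩
  by_contra hd
  obtain ⟨h0, hk⟩ := not_pow_dvd_iff.1 hd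
  obtain ⟨j, hj0, hj, hv⟩ := exists_val_add_eq c.2 (val (i + c.1))
  have e1 : (2 : ℤ) ^ (val (i + c.1) + 1) ≤ 2 ^ k := pow_le_pow_right₀ (by norm_num) hk
  have e2 : (2 : ℤ) ^ (k + 2) = 4 * 2 ^ k := by ring
  have e3 : (0 : ℤ) < 2 ^ (val (i + c.1) + 1) := by positivity
  have hv' : val (j + 2 ^ (val (i + c.1) + 1) + c.2) = val (i + c.1) := by
    rw [← hv]
    have hj0 : j + c.2 ≠ 0 := by
      have := (hc (i, j) ⟨by grind, by grind⟩).2.1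
      simp only at this
      lia
    refine (val_congr (k := val (j + c.2) + 1) (not_pow_dvd_iff.2 ⟨hj0, by lia⟩) ?_).2
    rw [hv]
    exact ⟨-1, by ring⟩
  have := h (x := j) (by
      simp only [Set.mem_ofPred_eq]
      rw [hc.eq (by grind) (by grind), isCross_cell, hv]) (y := j + 2 ^ (val (i + c.1) + 1)) (by
      simp only [Set.mem_ofPred_eq]
      rw [hc.eq (by grind) (by grind), isCross_cell, hv'])
  lia

theorem exists_not_pow_dvd' {x : Config} {j : ℤ} (h : ¬ IsHorizontalFaultLine x j) :
    ∃ (k : ℕ) (R : ℤ), ∀ c, Occurs R x c → ¬ (2 : ℤ) ^ k ∣ j + c.2 := by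
  obtain ⟨k, R, hR⟩ := exists_not_pow_dvd (mt isVerticalFaultLine_reflect.1 h)
  exact ⟨k, R, fun c hc => hR _ hc.reflect⟩

theorem exists_pow_dvd' {x : Config} {j : ℤ} (h : IsHorizontalFaultLine x j) (k : ℕ) :
    ∃ R : ℤ, ∀ c, Occurs R x c → (2 : ℤ) ^ k ∣ j + c.2 := by
  obtain ⟨R, hR⟩ := exists_pow_dvd (isVerticalFaultLine_reflect.2 h) k
  exact ⟨R, fun c hc => hR _ hc.reflect⟩

/-- The distance of two vertical fault lines is divisible by every power of `2`. -/
theorem IsVerticalFaultLine.eq {x : Config} (hx : x ∈ minimalShift) {i i' : ℤ}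
    (h : IsVerticalFaultLine x i) (h' : IsVerticalFaultLine x i') : i = i' := by
  obtain ⟨k, hk⟩ := exists_lt_two_pow |i - i'|
  obtain ⟨R, hR⟩ := exists_pow_dvd h k
  obtain ⟨R', hR'⟩ := exists_pow_dvd h' k
  obtain ⟨c, hc⟩ := hx (max R R')
  have h1 := dvd_sub (hR c (hc.mono (le_max_left _ _))) (hR' c (hc.mono (le_max_right _ _)))
  rw [add_sub_add_right_eq_sub] at h1
  exact sub_eq_zero.1 (Int.eq_zero_of_abs_lt_dvd h1 hk)

/-- Patterns of `x` and of `y` occur in the hierarchical configuration at positions that are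
congruent modulo large powers of `2`. -/
def SameOffset (x y : Config) : Prop :=
  ∀ (k : ℕ) (R : ℤ), ∃ c c' : ℤ × ℤ, (2 : ℤ) ^ k ∣ c.1 - c'.1 ∧ (2 : ℤ) ^ k ∣ c.2 - c'.2 ∧
    Occurs R x c ∧ Occurs R y c'

theorem SameOffset.symm {x y : Config} (h : SameOffset x y) : SameOffset y x := fun k R => by
  obtain ⟨c, c', h1, h2, h3, h4⟩ := h k R
  exact ⟨c', c, (dvd_sub_comm).1 h1, (dvd_sub_comm).1 h2, h4, h3⟩

theorem SameOffset.isVerticalFaultLine {x y : Config} (h : SameOffset x y) {i : ℤ}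
    (hy : IsVerticalFaultLine y i) : IsVerticalFaultLine x i := by
  by_contra hx
  obtain ⟨k, R, hR⟩ := exists_not_pow_dvd hx
  obtain ⟨R', hR'⟩ := exists_pow_dvd hy k
  obtain ⟨c, c', h1, -, h3, h4⟩ := h k (max R R')
  refine hR c (h3.mono (le_max_left _ _)) ?_
  have := dvd_add (hR' c' (h4.mono (le_max_right _ _))) h1
  rwa [show i + c'.1 + (c.1 - c'.1) = i + c.1 by ring] at this

theorem SameOffset.isHorizontalFaultLine {x y : Config} (h : SameOffset x y) {i : ℤ}
    (hy : IsHorizontalFaultLine y i) : IsHorizontalFaultLine x i := by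
  by_contra hx
  obtain ⟨k, R, hR⟩ := exists_not_pow_dvd' hx
  obtain ⟨R', hR'⟩ := exists_pow_dvd' hy k
  obtain ⟨c, c', -, h1, h3, h4⟩ := h k (max R R')
  refine hR c (h3.mono (le_max_left _ _)) ?_
  have := dvd_add (hR' c' (h4.mono (le_max_right _ _))) h1
  rwa [show i + c'.2 + (c.2 - c'.2) = i + c.2 by ring] at this

/-- Off the fault lines both coordinates have bounded order, and there tiles at congruent positions
are equal by `cell_congr`. -/
theorem SameOffset.coincideOffFaultLines {x y : Config} (h : SameOffset x y) :
    CoincideOffFaultLines x y := by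
  refine ⟨?_, fun p hp => ?_⟩
  · ext p
    exact or_congr ⟨h.symm.isVerticalFaultLine, h.isVerticalFaultLine⟩
      ⟨h.symm.isHorizontalFaultLine, h.isHorizontalFaultLine⟩
  · simp only [faultSet, Set.mem_compl_iff, Set.mem_ofPred_eq, not_or] at hp
    obtain ⟨k, R, hR⟩ := exists_not_pow_dvd hp.1
    obtain ⟨k', R', hR'⟩ := exists_not_pow_dvd' hp.2
    obtain ⟨c, c', h1, h2, h3, h4⟩ := h (max k k' + 1) (max (max R R') (|p.1| + |p.2|))
    have hp' : p ∈ box (max (max R R') (|p.1| + |p.2|)) :=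
      box_mono (le_max_right _ _) (mem_box_self p)
    have h5 := hR c (h3.mono ((le_max_left _ _).trans (le_max_left _ _)))
    have h6 := hR' c (h3.mono ((le_max_right _ _).trans (le_max_left _ _)))
    rw [(h3 p hp').2.2, (h4 p hp').2.2]
    refine cell_congr (k := max k k') (fun hd => h5 ((pow_dvd_pow 2 (le_max_left _ _)).trans hd))
      (fun hd => h6 ((pow_dvd_pow 2 (le_max_right _ _)).trans hd)) ?_ ?_
    · rwa [add_sub_add_left_eq_sub]
    · rwa [add_sub_add_left_eq_sub]

/-! ### Coincidence off the fault lines. -/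

theorem CoincideOffFaultLines.symm {x y : Config} (h : CoincideOffFaultLines x y) :
    CoincideOffFaultLines y x :=
  ⟨h.1.symm, by rw [← h.1]; exact h.2.symm⟩

theorem CoincideOffFaultLines.trans {x y z : Config} (h : CoincideOffFaultLines x y)
    (h' : CoincideOffFaultLines y z) : CoincideOffFaultLines x z :=
  ⟨h.1.trans h'.1, h.2.trans (by rw [h.1]; exact h'.2)⟩

theorem faultSet_reflect (x : Config) : faultSet (reflect x) = Prod.swap ⁻¹' faultSet x := by
  ext p
  simp only [faultSet, Set.mem_ofPred_eq, isVerticalFaultLine_reflect,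
    isHorizontalFaultLine_reflect, Set.mem_preimage, Prod.fst_swap, Prod.snd_swap]
  exact or_comm

theorem CoincideOffFaultLines.reflect {x y : Config} (h : CoincideOffFaultLines x y) :
    CoincideOffFaultLines (reflect x) (reflect y) := by
  refine ⟨by rw [faultSet_reflect, faultSet_reflect, h.1], fun p hp => ?_⟩
  rw [faultSet_reflect] at hp
  exact congrArg Tile.transpose (h.2 (x := p.swap) hp)

/-- The union of the fault lines determines each of them: a column covered only by horizontal fault
lines would need more than one of these. -/
theorem isVerticalFaultLine_iff_forall {x : Config} {i : ℤ} (hx : x ∈ minimalShift) :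
    IsVerticalFaultLine x i ↔ ∀ j, (i, j) ∈ faultSet x := by
  refine ⟨fun h j => Or.inl h, fun h => ?_⟩
  have h0 := h 0
  have h1 := h 1
  by_contra hv
  have e0 : IsHorizontalFaultLine x 0 := h0.resolve_left hv
  have e1 : IsHorizontalFaultLine x 1 := h1.resolve_left hv
  have := IsVerticalFaultLine.eq (reflect_mem_minimalShift hx) (isVerticalFaultLine_reflect.2 e0)
    (isVerticalFaultLine_reflect.2 e1)
  lia

theorem CoincideOffFaultLines.isVerticalFaultLine {x y : Config} (h : CoincideOffFaultLines x y)
    (hx : x ∈ minimalShift) (hy : y ∈ minimalShift) {i : ℤ} (hi : IsVerticalFaultLine x i) :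
    IsVerticalFaultLine y i := by
  rw [isVerticalFaultLine_iff_forall hx, h.1] at hi
  exact (isVerticalFaultLine_iff_forall hy).2 hi

theorem CoincideOffFaultLines.isHorizontalFaultLine {x y : Config}
    (h : CoincideOffFaultLines x y) (hx : x ∈ minimalShift) (hy : y ∈ minimalShift) {i : ℤ}
    (hi : IsHorizontalFaultLine x i) : IsHorizontalFaultLine y i :=
  isVerticalFaultLine_reflect.1 (h.reflect.isVerticalFaultLine (reflect_mem_minimalShift hx)
    (reflect_mem_minimalShift hy) (isVerticalFaultLine_reflect.2 hi))

/-- A point with a vertical and a horizontal fault line is a translate of a blow-up. -/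
theorem eq_shift_blowup {x : Config} (hx : x ∈ minimalShift) {a b : ℤ}
    (ha : IsVerticalFaultLine x a) (hb : IsHorizontalFaultLine x b) :
    x = shift (-a, -b) (blowup (x (a, b))) := by
  funext p
  obtain ⟨k, hk⟩ := exists_lt_two_pow (|a| + |b| + |p.1| + |p.2|)
  obtain ⟨R, hR⟩ := exists_pow_dvd ha (k + 2)
  obtain ⟨R', hR'⟩ := exists_pow_dvd' hb (k + 2)
  obtain ⟨c, hc⟩ := hx (max (max R R') (|a| + |b| + |p.1| + |p.2|))
  obtain ⟨A, hA⟩ := hR c (hc.mono (by grind))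
  obtain ⟨B, hB⟩ := hR' c (hc.mono (by grind))
  have h1 := hc (a, b) ⟨by grind, by grind⟩
  have h2 := hc p ⟨by grind, by grind⟩
  simp only at h1
  have hA0 : A ≠ 0 := by rintro rfl; lia
  have hB0 : B ≠ 0 := by rintro rfl; lia
  rw [h2.2.2, h1.2.2, hA, hB, cell_pow_mul hA0 hB0,
    show p.1 + c.1 = 2 ^ (k + 2) * A + (p.1 + -a) by lia,
    show p.2 + c.2 = 2 ^ (k + 2) * B + (p.2 + -b) by lia,
    cell_pow_mul_add hA0 hB0 (by grind) (by grind)]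
  rfl

/-! ### Points whose only fault line is vertical. -/

theorem exists_forall_not_pow_dvd {x : Config} (h : ∀ j, ¬ IsHorizontalFaultLine x j) (R : ℤ) :
    ∃ (k : ℕ) (R' : ℤ), ∀ c, Occurs R' x c → ∀ j, |j| ≤ R → ¬ (2 : ℤ) ^ k ∣ j + c.2 := by
  choose k R' hR' using fun j => exists_not_pow_dvd' (h j)
  obtain ⟨K, hK⟩ := ((Set.finite_Icc (-R) R).image k).bddAbove
  obtain ⟨M, hM⟩ := ((Set.finite_Icc (-R) R).image R').bddAbove
  refine ⟨K, M, fun c hc j hj hd => ?_⟩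
  have hj' : j ∈ Set.Icc (-R) R := abs_le.1 hj
  exact hR' j c (hc.mono (hM ⟨j, hj', rfl⟩)) ((pow_dvd_pow 2 (hK ⟨j, hj', rfl⟩)).trans hd)

/-- The position of a point whose only fault line is vertical. -/
theorem exists_offset {x : Config} (hx : x ∈ minimalShift) {a : ℤ} (ha : IsVerticalFaultLine x a)
    (h : ∀ j, ¬ IsHorizontalFaultLine x j) (R : ℤ) (k : ℕ) :
    ∃ (K : ℕ) (c : ℤ × ℤ) (A B b : ℤ), k ≤ K ∧ R + |a| < 2 ^ K ∧ Occurs (R + |a|) x c ∧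
      a + c.1 = 2 ^ (K + 2) * A ∧ c.2 = 2 ^ (K + 2) * B + b ∧
      ∀ j, |j| ≤ R → 0 < b + j ∧ b + j < 2 ^ (K + 2) ∧ ¬ (2 : ℤ) ^ K ∣ j + c.2 := by
  obtain ⟨k₁, R₁, h₁⟩ := exists_forall_not_pow_dvd h R
  obtain ⟨k₂, h₂⟩ := exists_lt_two_pow (R + |a|)
  set K := max k (max k₁ k₂) with hK
  obtain ⟨R₃, h₃⟩ := exists_pow_dvd ha (K + 2)
  obtain ⟨c, hc⟩ := hx (max (max R₁ R₃) (R + |a|))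
  obtain ⟨A, hA⟩ := h₃ c (hc.mono (by grind))
  have hnd : ∀ j, |j| ≤ R → ¬ (2 : ℤ) ^ K ∣ j + c.2 := fun j hj hd =>
    h₁ c (hc.mono (by grind)) j hj ((pow_dvd_pow 2 (by lia)).trans hd)
  have hdiv := Int.mul_ediv_add_emod c.2 (2 ^ (K + 2))
  have hpos : (0 : ℤ) < 2 ^ (K + 2) := by positivity
  have hb0 := Int.emod_nonneg c.2 hpos.ne'
  have hb1 := Int.emod_lt_of_pos c.2 hpos
  have hdv : (2 : ℤ) ^ K ∣ 2 ^ (K + 2) := pow_dvd_pow 2 (by lia)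
  refine ⟨K, c, A, c.2 / 2 ^ (K + 2), c.2 % 2 ^ (K + 2), by lia,
    h₂.trans_le (pow_le_pow_right₀ (by norm_num) (by lia)), hc.mono (by grind), hA, hdiv.symm,
    fun j hj => ⟨?_, ?_, hnd j hj⟩⟩
  -- Otherwise a row whose position is a multiple of `2 ^ (K + 2)` would meet the window, where all
  -- orders are less than `K`.
  · by_contra hcon
    refine hnd (-(c.2 % 2 ^ (K + 2))) (by grind) ?_
    rw [show -(c.2 % 2 ^ (K + 2)) + c.2 = 2 ^ (K + 2) * (c.2 / 2 ^ (K + 2)) by lia]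
    exact hdv.mul_right _
  · by_contra hcon
    refine hnd (2 ^ (K + 2) - c.2 % 2 ^ (K + 2)) (by grind) ?_
    rw [show 2 ^ (K + 2) - c.2 % 2 ^ (K + 2) + c.2 = 2 ^ (K + 2) * (c.2 / 2 ^ (K + 2) + 1) by
      rw [mul_add]; lia]
    exact hdv.mul_right _

theorem cell_eq_axisMark_vertical {A B q : ℤ} {K : ℕ} (hA : A ≠ 0) (h0 : 0 < q)
    (hq : q < 2 ^ (K + 2)) (hd : ¬ (2 : ℤ) ^ K ∣ 2 ^ (K + 2) * B + q) :
    cell (2 ^ (K + 2) * A) (2 ^ (K + 2) * B + q) = (axisMark A B).vertical := by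
  rw [not_pow_dvd_iff] at hd
  rw [cell_eq_vertical, axisMark_pow_mul_add hA _ _ h0.le hq]
  rw [val_pow_mul hA]
  lia

theorem EdgeMark.vertical_top (m : EdgeMark) : m.vertical.top = m := rfl

/-- A vertical fault line of a point without horizontal fault lines is constant. -/
theorem exists_forall_eq_vertical {x : Config} (hx : x ∈ minimalShift) {a : ℤ}
    (ha : IsVerticalFaultLine x a) (h : ∀ j, ¬ IsHorizontalFaultLine x j) :
    ∃ m : EdgeMark, ∀ j, x (a, j) = m.vertical := by
  -- Each window lies within one block of length `2 ^ (K + 2)`, on which the mark is constant; all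
  -- windows contain the row `0`, so their marks agree.
  have key : ∀ R : ℤ, ∃ m : EdgeMark, ∀ j, |j| ≤ R → x (a, j) = m.vertical := fun R => by
    obtain ⟨K, c, A, B, b, -, -, hc, hA, hB, hj⟩ := exists_offset hx ha h R 0
    refine ⟨axisMark A B, fun j hjR => ?_⟩
    obtain ⟨h1, h2, h3⟩ := hj j hjR
    have h4 := hc (a, j) ⟨by grind, by grind⟩
    simp only at h4
    have hA0 : A ≠ 0 := by rintro rfl; lia
    rw [show j + c.2 = 2 ^ (K + 2) * B + (b + j) by lia] at h3 h4
    rw [h4.2.2, hA, cell_eq_axisMark_vertical hA0 h1 h2 h3]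
  obtain ⟨m, hm⟩ := key 0
  refine ⟨m, fun j => ?_⟩
  obtain ⟨m', hm'⟩ := key |j|
  rw [hm' j le_rfl, ← hm' 0 (by simp), hm 0 (by simp)]

/-- The family `g` of configurations is seen near the positions of the hierarchical configuration
that are congruent to a given one modulo large powers of `2`. -/
def Realizes (g : Tile → Config) : Prop :=
  ∀ (R : ℤ) (k : ℕ), ∃ (K : ℕ) (o : ℤ × ℤ), k ≤ K ∧ ∀ A B : ℤ, 0 < A → 0 < B →
    Occurs R (g (cell A B)) (2 ^ K * A + o.1, 2 ^ K * B + o.2)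

theorem realizes_shift_blowup (v : ℤ × ℤ) : Realizes fun t => shift v (blowup t) := fun R k => by
  obtain ⟨K, hK⟩ := exists_lt_two_pow (R + (|v.1| + |v.2|))
  refine ⟨max k K + 2, v, by lia, fun A B hA hB => ?_⟩
  exact (occurs_blowup hA hB (hK.trans_le (pow_le_pow_right₀ (by norm_num) (by lia)))).shift

/-- Off the fault line the tile depends only on the position modulo `2 ^ (K + 1)`. The multipliers
`A`, `B` of `2 ^ (K + 2)` are therefore free, and they affect only the mark on the line. -/
theorem realizes_vertical {x : Config} (hx : x ∈ minimalShift) {a : ℤ}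
    (ha : IsVerticalFaultLine x a) (h : ∀ j, ¬ IsHorizontalFaultLine x j) :
    Realizes fun t p => if p.1 = a then t.top.vertical else x p := fun R k => by
  obtain ⟨K, c, A', B', b, hkK, hK, hc, hA', hB', hj⟩ := exists_offset hx ha h R k
  refine ⟨K + 2, (-a, b), by lia, fun A B hA hB p hp => ?_⟩
  obtain ⟨hp1, hp2⟩ := hp
  obtain ⟨h1, h2, h3⟩ := hj p.2 hp2
  have hKK : (2 : ℤ) ^ K < 2 ^ (K + 2) := pow_lt_pow_right₀ (by norm_num) (by lia)
  have h4 : (2 : ℤ) ^ (K + 2) * 1 ≤ 2 ^ (K + 2) * A := by gcongr; lia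
  have h5 : (0 : ℤ) < 2 ^ (K + 2) * B := by positivity
  have h6 := hc p ⟨by grind, by grind⟩
  have hd2 : (2 : ℤ) ^ (K + 1) ∣ p.2 + c.2 - (p.2 + (2 ^ (K + 2) * B + b)) := by
    rw [hB', show p.2 + (2 ^ (K + 2) * B' + b) - (p.2 + (2 ^ (K + 2) * B + b)) =
      2 ^ (K + 1) * (2 * (B' - B)) by ring]
    exact dvd_mul_right _ _
  refine ⟨by grind, by simp only; lia, ?_⟩
  simp only
  split_ifs with hpa
  · rw [cell_top hA.ne' hB.ne',
      show p.1 + (2 ^ (K + 2) * A + -a) = 2 ^ (K + 2) * A by lia,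
      show p.2 + (2 ^ (K + 2) * B + b) = 2 ^ (K + 2) * B + (b + p.2) by ring,
      cell_eq_axisMark_vertical hA.ne' h1 h2]
    intro hcon
    refine h3 ?_
    have := dvd_add ((pow_dvd_pow 2 (by lia : K ≤ K + 1)).trans hd2) hcon
    rwa [show p.2 + c.2 - (p.2 + (2 ^ (K + 2) * B + b)) + (2 ^ (K + 2) * B + (b + p.2)) =
      p.2 + c.2 by ring] at this
  · rw [h6.2.2]
    refine cell_congr (k := K) (fun hcon => ?_) h3 ?_ hd2
    · have h7 : (2 : ℤ) ^ K ∣ a + c.1 := by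
        rw [hA']
        exact (pow_dvd_pow 2 (by lia)).mul_right _
      have h8 := dvd_sub hcon h7
      rw [add_sub_add_right_eq_sub] at h8
      exact not_pow_dvd_of_abs_lt (q := p.1 - a) (by lia) (by grind) h8
    · rw [show p.1 + c.1 - (p.1 + (2 ^ (K + 2) * A + -a)) = 2 ^ (K + 1) * (2 * (A' - A)) by
        rw [show p.1 + c.1 - (p.1 + (2 ^ (K + 2) * A + -a)) = a + c.1 - 2 ^ (K + 2) * A by ring,
          hA']
        ring]
      exact dvd_mul_right _ _

theorem cell_of_lt {i j : ℤ} {k : ℕ} (h0 : 0 < j) (hj : j < 2 ^ k) (hk : k + 1 ≤ val i) :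
    cell i j = .verticalArm false 0 false := by
  have h1 := (not_pow_dvd_iff.1 (not_pow_dvd_of_abs_lt h0.ne' (by rwa [abs_of_pos h0]))).2
  have h2 : quarter (val i) j = 0 := by
    rw [quarter, Int.ediv_eq_zero_of_lt h0.le (hj.trans_le (pow_le_pow_right₀ (by norm_num)
      (by lia)))]
    rfl
  rw [cell_eq_vertical (by lia)]
  simp [EdgeMark.vertical, axisMark, h2]

/-- A downward arm without side arrows occurs in the same row and in the same column as any given
tile. -/
theorem exists_cell_row_column (t : Tile) : ∃ A B A' B' : ℤ, 0 < A ∧ 0 < B ∧ 0 < A' ∧ 0 < B' ∧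
    cell A B = t ∧ cell A' B = .verticalArm false 0 false ∧
    cell A B' = .verticalArm false 0 false := by
  obtain ⟨a, b, ha, hb, rfl⟩ := exists_cell_eq t
  obtain ⟨k, hk⟩ := exists_lt_two_pow (2 ^ 2 * b)
  -- The factor `4` gives the column order at least two, so that its tile in the row `1` has single
  -- transverse arrows; the column `2 ^ (k + 1)` is of high order compared with the row `2 ^ 2 * b`.
  refine ⟨2 ^ 2 * a, 2 ^ 2 * b, 2 ^ (k + 1), 1, by positivity, by positivity, by positivity,
    by positivity, cell_pow_mul ha.ne' hb.ne' 2, cell_of_lt (by positivity) hk ?_,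
    cell_of_lt (k := 1) (by lia) (by lia) ?_⟩
  · have := val_pow_mul one_ne_zero (k + 1)
    rw [mul_one] at this
    lia
  · rw [val_pow_mul ha.ne']
    lia

end Robinson

namespace Robinson

open Topology CubeSystem Filter

/-! ### The space of cubes of the minimal Robinson system -/

instance : Finite Tile := by
  refine Finite.of_surjective (fun w : Fin 3 × Bool × Bool × SignType × Bool =>
    if w.1 = 0 then Tile.cross w.2.1 w.2.2.1
    else if w.1 = 1 then Tile.horizontalArm w.2.1 w.2.2.2.1 w.2.2.2.2
    else Tile.verticalArm w.2.1 w.2.2.2.1 w.2.2.2.2) fun t => ?_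
  cases t with
  | cross e n => exact ⟨(0, e, n, 0, true), by simp⟩
  | horizontalArm e s d => exact ⟨(1, e, true, s, d), by simp⟩
  | verticalArm e s d => exact ⟨(2, e, true, s, d), by simp⟩

instance : CompactSpace minimalShift :=
  isCompact_iff_compactSpace.1 isClosed_minimalShift.isCompact

/-- The horizontal translation of the minimal Robinson system. -/
abbrev S : minimalShift ≃ₜ minimalShift := isSubshift_minimalShift.σ₁

/-- The vertical translation of the minimal Robinson system. -/
abbrev T : minimalShift ≃ₜ minimalShift := isSubshift_minimalShift.σ₂

theorem coe_S_zpow (n : ℤ) (x : minimalShift) : ((S ^ n) x : Config) = shift (n, 0) x :=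
  isSubshift_minimalShift.coe_σ₁_zpow n x

theorem coe_T_zpow (n : ℤ) (x : minimalShift) : ((T ^ n) x : Config) = shift (0, n) x :=
  isSubshift_minimalShift.coe_σ₂_zpow n x

theorem coe_S_zpow_T_zpow (n m : ℤ) (x : minimalShift) :
    ((S ^ n) ((T ^ m) x) : Config) = shift (n, m) x :=
  isSubshift_minimalShift.coe_mul_zpow (n, m) x

/-- Two configurations coincide on the square of radius `R`. -/
def Near (R : ℤ) (x y : minimalShift) : Prop := Set.EqOn (x : Config) y (box R)

theorem Near.mono {R R' : ℤ} {x y : minimalShift} (h : Near R' x y) (hR : R ≤ R') : Near R x y :=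
  Set.EqOn.mono (box_mono hR) h

theorem near_mem_nhds (R : ℤ) (x : minimalShift) : {y | Near R y x} ∈ 𝓝 x :=
  continuous_subtype_val.continuousAt.preimage_mem_nhds (eqOn_box_mem_nhds x R)

theorem exists_near_subset {x : minimalShift} {U : Set minimalShift} (hU : U ∈ 𝓝 x) :
    ∃ R : ℤ, 0 ≤ R ∧ ∀ y, Near R y x → y ∈ U := by
  obtain ⟨V, hV, hVU⟩ := mem_nhds_subtype _ _ _ |>.1 hU
  obtain ⟨R, hR0, hR⟩ := exists_box_subset hV
  exact ⟨R, hR0, fun y hy => hVU (hR y hy)⟩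

theorem exists_near_of_mem_cubes {w : minimalShift × minimalShift × minimalShift × minimalShift}
    (hw : w ∈ cubes S T) (R : ℤ) : ∃ (z : minimalShift) (n m : ℤ), Near R z w.1 ∧
      Near R ((S ^ n) z) w.2.1 ∧ Near R ((T ^ m) z) w.2.2.1 ∧
      Near R ((S ^ n) ((T ^ m) z)) w.2.2.2 := by
  have hU := prod_mem_nhds (near_mem_nhds R w.1) (prod_mem_nhds (near_mem_nhds R w.2.1)
    (prod_mem_nhds (near_mem_nhds R w.2.2.1) (near_mem_nhds R w.2.2.2)))
  obtain ⟨_, ⟨h1, h2, h3, h4⟩, z, n, m, rfl⟩ := mem_closure_iff_nhds.1 hw _ hU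
  exact ⟨z, n, m, h1, h2, h3, h4⟩

theorem mem_cubes_of_near {w : minimalShift × minimalShift × minimalShift × minimalShift}
    (h : ∀ R : ℤ, ∃ (z : minimalShift) (n m : ℤ), Near R z w.1 ∧
      Near R ((S ^ n) z) w.2.1 ∧ Near R ((T ^ m) z) w.2.2.1 ∧
      Near R ((S ^ n) ((T ^ m) z)) w.2.2.2) : w ∈ cubes S T := by
  obtain ⟨w₁, w₂, w₃, w₄⟩ := w
  refine mem_closure_iff_nhds.2 fun U hU => ?_
  obtain ⟨U₁, hU₁, V₁, hV₁, h₁⟩ := mem_nhds_prod_iff.1 hU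
  obtain ⟨U₂, hU₂, V₂, hV₂, h₂⟩ := mem_nhds_prod_iff.1 hV₁
  obtain ⟨U₃, hU₃, U₄, hU₄, h₃⟩ := mem_nhds_prod_iff.1 hV₂
  obtain ⟨R₁, -, hR₁⟩ := exists_near_subset hU₁
  obtain ⟨R₂, -, hR₂⟩ := exists_near_subset hU₂
  obtain ⟨R₃, -, hR₃⟩ := exists_near_subset hU₃
  obtain ⟨R₄, -, hR₄⟩ := exists_near_subset hU₄
  obtain ⟨z, n, m, e₁, e₂, e₃, e₄⟩ := h (max (max R₁ R₂) (max R₃ R₄))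
  refine ⟨(z, (S ^ n) z, (T ^ m) z, (S ^ n) ((T ^ m) z)), h₁ ⟨hR₁ _ (e₁.mono (by grind)), ?_⟩,
    z, n, m, rfl⟩
  exact h₂ ⟨hR₂ _ (e₂.mono (by grind)), h₃ ⟨hR₃ _ (e₃.mono (by grind)),
    hR₄ _ (e₄.mono (by grind))⟩⟩

/-- A criterion for the relation `R_S` without the fourth point, by compactness. -/
theorem relS_of_near {x y : minimalShift} (h : ∀ R : ℤ, ∃ (z : minimalShift) (n m : ℤ),
    Near R z x ∧ Near R ((S ^ n) z) y ∧ Near R ((T ^ m) z) ((S ^ n) ((T ^ m) z))) :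
    relS S T x y := by
  choose z n m h₁ h₂ h₃ using h
  -- A cluster point of the third vertices serves as `a`; the fourth vertices agree with them on
  -- growing squares.
  obtain ⟨a, ha⟩ := exists_clusterPt_of_compactSpace
    (Filter.map (fun R : ℤ => (T ^ m R) (z R)) atTop)
  refine ⟨a, mem_cubes_of_near fun R => ?_⟩
  have hfr := (mapClusterPt_iff_frequently.1 ha) _ (near_mem_nhds R a)
  obtain ⟨R', hR', hRR'⟩ := (hfr.and_eventually (eventually_ge_atTop R)).exists
  refine ⟨z R', n R', m R', (h₁ R').mono hRR', (h₂ R').mono hRR', hR', ?_⟩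
  exact ((h₃ R').mono hRR').symm.trans hR'

/-- The reflection along the diagonal on the minimal Robinson system. -/
def reflection (x : minimalShift) : minimalShift := ⟨reflect x, reflect_mem_minimalShift x.2⟩

@[simp] theorem reflection_reflection (x : minimalShift) : reflection (reflection x) = x :=
  Subtype.ext (reflect_reflect _)

theorem continuous_reflection : Continuous reflection := by
  refine Continuous.subtype_mk (continuous_pi fun p => ?_) _
  exact continuous_of_discreteTopology.comp
    ((continuous_apply (p.2, p.1)).comp continuous_subtype_val)

theorem reflection_shift (n m : ℤ) (x : minimalShift) :
    reflection ((S ^ n) ((T ^ m) x)) = (S ^ m) ((T ^ n) (reflection x)) := by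
  refine Subtype.ext ?_
  rw [coe_S_zpow_T_zpow]
  change reflect ((S ^ n) ((T ^ m) x) : minimalShift) = _
  rw [coe_S_zpow_T_zpow]
  rfl

theorem reflection_mem_cubes {x₀ x₁ x₂ x₃ : minimalShift} (h : (x₀, x₁, x₂, x₃) ∈ cubes S T) :
    (reflection x₀, reflection x₂, reflection x₁, reflection x₃) ∈ cubes S T := by
  have hc := continuous_reflection
  refine map_mem_closure (f := fun w : minimalShift × minimalShift × minimalShift × minimalShift =>
    (reflection w.1, reflection w.2.2.1, reflection w.2.1, reflection w.2.2.2)) (by fun_prop) h ?_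
  rintro _ ⟨z, n, m, rfl⟩
  refine ⟨reflection z, m, n, ?_⟩
  have h1 := reflection_shift n 0 z
  have h2 := reflection_shift 0 m z
  simp only [zpow_zero, Homeomorph.one_apply] at h1 h2
  simp only [h1, h2, reflection_shift]

theorem relT_of_relS_reflection {x y : minimalShift}
    (h : relS S T (reflection x) (reflection y)) : relT S T x y := by
  obtain ⟨a, ha⟩ := h
  exact ⟨reflection a, by simpa using reflection_mem_cubes ha⟩

theorem relST_reflection {x y : minimalShift} (h : relST S T x y) :
    relST S T (reflection x) (reflection y) := by
  obtain ⟨hS, b, hb⟩ := h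
  exact ⟨⟨reflection b, reflection_mem_cubes hb⟩, relT_of_relS_reflection (by simpa using hS)⟩

/-- Two positions of a row of the hierarchical configuration are congruent if the row looks the
same around them. -/
theorem pow_dvd_of_cell_eq {a b n R : ℤ} {k : ℕ} (hR : 2 ^ (k + 1) ≤ R)
    (h : ∀ p ∈ box R, 0 < p.1 + a ∧ 0 < p.1 + a + n ∧ 0 < p.2 + b ∧
      cell (p.1 + a) (p.2 + b) = cell (p.1 + a + n) (p.2 + b)) : (2 : ℤ) ^ k ∣ n := by
  -- A cross both of whose coordinates have order `k` is carried to a cross in the same row, whose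
  -- abscissa again has order `k`.
  obtain ⟨i, hi0, hi, hiv⟩ := exists_val_add_eq a k
  obtain ⟨j, hj0, hj, hjv⟩ := exists_val_add_eq b k
  obtain ⟨h1, h2, h3, h4⟩ := h (i, j) ⟨by grind, by grind⟩
  simp only at h1 h2 h3 h4
  have h5 : (cell (i + a + n) (j + b)).IsCross := by
    rw [← h4, isCross_cell, hiv, hjv]
  rw [isCross_cell, hjv] at h5
  have h6 := dvd_sub ((pow_dvd_iff h2.ne').2 h5.ge) ((pow_dvd_iff h1.ne').2 hiv.ge)
  rwa [add_sub_cancel_left] at h6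

/-- The third and fourth vertices of a nearby cube agree on a large square and are displaced by `(n,
0)`, so `n` is divisible by `2 ^ k`. The first two vertices have the same displacement. The relation
`relT` is not needed. -/
theorem sameOffset_of_relS {x y : minimalShift} (h : relS S T x y) :
    SameOffset (x : Config) y := fun k R => by
  obtain ⟨a, ha⟩ := h
  obtain ⟨z, n, m, h1, h2, h3, h4⟩ := exists_near_of_mem_cubes ha (max R (2 ^ (k + 1)))
  set R' := max R (2 ^ (k + 1)) with hR'
  simp only at h1 h2 h3 h4
  obtain ⟨c, hc⟩ := z.2 (R' + (|n| + |m|))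
  have hn := abs_nonneg n
  have hm := abs_nonneg m
  have e1 : Occurs R' z c := hc.mono (by lia)
  have e2 : Occurs R' (shift (n, 0) z) (c + (n, 0)) :=
    Occurs.shift (hc.mono (by simp only [abs_zero]; lia))
  have e3 : Occurs R' (shift (0, m) z) (c + (0, m)) :=
    Occurs.shift (hc.mono (by simp only [abs_zero]; lia))
  have e4 : Occurs R' (shift (n, m) z) (c + (n, m)) := Occurs.shift hc
  have h34 := h3.trans h4.symm
  rw [Near, coe_S_zpow] at h2
  rw [coe_T_zpow, coe_S_zpow_T_zpow] at h34
  have hdvd : (2 : ℤ) ^ k ∣ n := by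
    refine pow_dvd_of_cell_eq (a := c.1) (b := c.2 + m) (le_max_right R _) fun p hp => ?_
    obtain ⟨f1, f2, f3⟩ := e3 p hp
    obtain ⟨g1, -, g3⟩ := e4 p hp
    rw [h34 hp, g3] at f3
    simp only [Prod.fst_add, Prod.snd_add, add_zero] at f1 f2 f3 g1
    rw [← add_assoc] at g1 f3
    exact ⟨f1, g1, f2, f3.symm⟩
  refine ⟨c, c + (n, 0), ?_, by simp, (e1.congr h1.symm).mono (le_max_left _ _),
    (e2.congr h2.symm).mono (le_max_left _ _)⟩
  simpa using hdvd

/-- Near the horizontal axis the right half of a blow-up is periodic: on columns of high order the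
tile depends only on the sign of `q`, the other columns are periodic by `cell_congr`, and the half
axis is constant. -/
theorem blowup_eq_of_pow_dvd {t : Tile} {i i' q : ℤ} {k : ℕ} (hi : 0 < i) (hi' : 0 < i')
    (hq : |q| < 2 ^ k) (h : (2 : ℤ) ^ (k + 2) ∣ i - i') : blowup t (i, q) = blowup t (i', q) := by
  rcases eq_or_ne q 0 with rfl | hq0
  · simp [blowup, hi, hi', hi.ne', hi'.ne']
  rw [blowup_of_ne hi.ne' hq0, blowup_of_ne hi'.ne' hq0]
  have hqd := not_pow_dvd_of_abs_lt hq0 hq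
  by_cases hd : (2 : ℤ) ^ (k + 1) ∣ i
  · have key : ∀ i, 0 < i → (2 : ℤ) ^ (k + 1) ∣ i →
        cell i q = .verticalArm (decide (q < 0)) 0 false := by
      intro i hi hd
      have h1 := (pow_dvd_iff hi.ne').1 hd
      have h2 := (not_pow_dvd_iff.1 hqd).2
      have h3 : (2 : ℤ) ^ k ≤ 2 ^ val i := pow_le_pow_right₀ (by norm_num) (by lia)
      have h4 : quarter (val i) q = if q < 0 then 3 else 0 := by
        split_ifs with hneg
        · have := quarter_pow_mul_add (k := val i) 0 (-1) (q := 2 ^ val i + q) (by grind) (by lia)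
          rw [show 2 ^ val i * (-1) + (2 ^ val i + q) = q by ring] at this
          simpa [quarter] using this
        · rw [quarter, Int.ediv_eq_zero_of_lt (by lia) (by grind)]
          rfl
      rw [cell_eq_vertical (by lia), EdgeMark.vertical, axisMark, h4]
      split_ifs <;> simp_all
    rw [key i hi hd, key i' hi' ((dvd_iff_dvd_of_dvd_sub
      ((pow_dvd_pow 2 (by lia)).trans h)).1 hd)]
  · exact cell_congr hd (fun hd' => hqd ((pow_dvd_pow 2 (by lia)).trans hd')) h (by simp)

/-- All blow-ups equal `cell` off the axes, so the tile `t` is arbitrary. -/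
theorem near_shift_blowup {R : ℤ} {x : minimalShift} {c : ℤ × ℤ} (h : Occurs R x c) (t : Tile) :
    Set.EqOn (shift c (blowup t)) x (box R) := fun p hp => by
  obtain ⟨h1, h2, h3⟩ := h p hp
  rw [h3]
  exact blowup_of_ne h1.ne' h2.ne'

/-- Points that are seen in the same row of the hierarchical configuration, at congruent positions,
are related by `R_S`. -/
theorem relS_of_occurs {x y : minimalShift} (h : ∀ (k : ℕ) (R : ℤ), ∃ c c' : ℤ × ℤ, c.2 = c'.2 ∧
    (2 : ℤ) ^ k ∣ c.1 - c'.1 ∧ Occurs R x c ∧ Occurs R y c') : relS S T x y := by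
  refine relS_of_near fun R => ?_
  obtain ⟨k, hk⟩ := exists_lt_two_pow R
  obtain ⟨c, c', hc, hd, hx, hy⟩ := h (k + 2) R
  let t : Tile := .cross true true
  let z₀ : minimalShift := ⟨blowup t, blowup_mem_minimalShift t⟩
  -- The vertical displacement `-c.2` leads down to the horizontal axis of the blow-up, where the
  -- two abscissas show the same tiles.
  refine ⟨(S ^ c.1) ((T ^ c.2) z₀), c'.1 - c.1, -c.2, ?_, ?_, ?_⟩
  · rw [Near, coe_S_zpow_T_zpow]
    exact near_shift_blowup hx t
  · rw [Near, coe_S_zpow, coe_S_zpow_T_zpow, shift_shift, hc]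
    simpa using near_shift_blowup hy t
  · simp only [Near, coe_T_zpow, coe_S_zpow_T_zpow, shift_shift]
    intro p hp
    have h1 := (hx p hp).1
    have h2 := (hy p hp).1
    have := blowup_eq_of_pow_dvd (t := t) h1 h2 (hp.2.trans_lt hk) (by simpa using hd)
    simp only [z₀, shift_apply]
    convert this using 2 <;> ext <;> simp

theorem relT_of_occurs {x y : minimalShift} (h : ∀ (k : ℕ) (R : ℤ), ∃ c c' : ℤ × ℤ, c.1 = c'.1 ∧
    (2 : ℤ) ^ k ∣ c.2 - c'.2 ∧ Occurs R x c ∧ Occurs R y c') : relT S T x y := by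
  refine relT_of_relS_reflection (relS_of_occurs fun k R => ?_)
  obtain ⟨c, c', hc, hd, hx, hy⟩ := h k R
  exact ⟨c.swap, c'.swap, hc, hd, hx.reflect, hy.reflect⟩

/-! ### Families of points that differ only on fault lines. -/

theorem Realizes.mem {g : Tile → Config} (hg : Realizes g) (t : Tile) : g t ∈ minimalShift :=
  fun R => by
    obtain ⟨A, B, hA, hB, rfl⟩ := exists_cell_eq t
    obtain ⟨K, o, -, h⟩ := hg R 0
    exact ⟨_, h A B hA hB⟩

/-- The tile `t` shares a row of `cell` with one downward single arm and a column with another,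
which gives the two halves of the relation. This arm is a common neighbour of all members of the
family. -/
theorem Realizes.relST {g : Tile → Config} (hg : Realizes g) (t : Tile) :
    relST S T ⟨g t, hg.mem t⟩ ⟨g (.verticalArm false 0 false), hg.mem _⟩ := by
  obtain ⟨A, B, A', B', hA, hB, hA', hB', h1, h2, h3⟩ := exists_cell_row_column t
  constructor
  · refine relS_of_occurs fun k R => ?_
    obtain ⟨K, o, hK, h⟩ := hg R k
    rw [← h1, ← h2]
    refine ⟨(2 ^ K * A + o.1, _), (2 ^ K * A' + o.1, _), rfl, ?_, h A B hA hB, h A' B hA' hB⟩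
    simp only
    rw [add_sub_add_right_eq_sub, ← mul_sub]
    exact (pow_dvd_pow 2 hK).mul_right _
  · refine relT_of_occurs fun k R => ?_
    obtain ⟨K, o, hK, h⟩ := hg R k
    rw [← h1, ← h3]
    refine ⟨(_, 2 ^ K * B + o.2), (_, 2 ^ K * B' + o.2), rfl, ?_, h A B hA hB, h A B' hA hB'⟩
    simp only
    rw [add_sub_add_right_eq_sub, ← mul_sub]
    exact (pow_dvd_pow 2 hK).mul_right _

theorem Realizes.eqvGen {g : Tile → Config} (hg : Realizes g) {x y : minimalShift} {t t' : Tile}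
    (hx : (x : Config) = g t) (hy : (y : Config) = g t') :
    Relation.EqvGen (CubeSystem.relST S T) x y := by
  obtain rfl : x = ⟨g t, hg.mem t⟩ := Subtype.ext hx
  obtain rfl : y = ⟨g t', hg.mem t'⟩ := Subtype.ext hy
  exact .trans _ _ _ (.rel _ _ (hg.relST t)) (.symm _ _ (.rel _ _ (hg.relST t')))

/-- A point whose only fault line is vertical, in terms of the mark on the line. -/
theorem eqvGen_of_vertical {x y : minimalShift} (h : CoincideOffFaultLines (x : Config) y) {a : ℤ}
    (ha : IsVerticalFaultLine (x : Config) a) (hx : ∀ j, ¬ IsHorizontalFaultLine (x : Config) j) :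
    Relation.EqvGen (CubeSystem.relST S T) x y := by
  have hy : ∀ j, ¬ IsHorizontalFaultLine (y : Config) j := fun j hj =>
    hx j (h.symm.isHorizontalFaultLine y.2 x.2 hj)
  obtain ⟨m, hm⟩ := exists_forall_eq_vertical x.2 ha hx
  obtain ⟨m', hm'⟩ := exists_forall_eq_vertical y.2 (h.isVerticalFaultLine x.2 y.2 ha) hy
  refine (realizes_vertical x.2 ha hx).eqvGen (t := m.vertical) (t' := m'.vertical) ?_ ?_
  · funext ⟨i, j⟩
    simp only [EdgeMark.vertical_top]
    split_ifs with hi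
    · rw [hi, hm]
    · rfl
  · funext ⟨i, j⟩
    simp only [EdgeMark.vertical_top]
    split_ifs with hi
    · rw [hi, hm']
    · refine (h.2 fun hmem => ?_).symm
      rcases hmem with hv | hh
      · exact hi (hv.eq x.2 ha)
      · exact hx j hh

theorem eqvGen_reflection {x y : minimalShift}
    (h : Relation.EqvGen (CubeSystem.relST S T) x y) :
    Relation.EqvGen (CubeSystem.relST S T) (reflection x) (reflection y) := by
  induction h with
  | rel x y h => exact .rel _ _ (relST_reflection h)
  | refl x => exact .refl _
  | symm x y _ ih => exact .symm _ _ ih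
  | trans x y z _ _ ih ih' => exact .trans _ _ _ ih ih'

/-- For the converse, the fault lines decide: with both, the points are translated blow-ups; with
one, they differ in the constant mark on it; with none, they are equal. -/
theorem eqvGen_iff {x y : minimalShift} : Relation.EqvGen (CubeSystem.relST S T) x y ↔
    CoincideOffFaultLines (x : Config) y := by
  constructor
  · intro h
    induction h with
    | rel x y h => exact (sameOffset_of_relS h.1).coincideOffFaultLines
    | refl x => exact ⟨rfl, Set.eqOn_refl _ _⟩
    | symm x y _ ih => exact ih.symm
    | trans x y z _ _ ih ih' => exact ih.trans ih'
  · intro h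
    by_cases hv : ∃ a, IsVerticalFaultLine (x : Config) a <;>
      by_cases hh : ∃ b, IsHorizontalFaultLine (x : Config) b
    · obtain ⟨a, ha⟩ := hv
      obtain ⟨b, hb⟩ := hh
      exact (realizes_shift_blowup (-a, -b)).eqvGen (eq_shift_blowup x.2 ha hb)
        (eq_shift_blowup y.2 (h.isVerticalFaultLine x.2 y.2 ha)
          (h.isHorizontalFaultLine x.2 y.2 hb))
    · obtain ⟨a, ha⟩ := hv
      exact eqvGen_of_vertical h ha (not_exists.1 hh)
    · obtain ⟨b, hb⟩ := hh
      have := eqvGen_of_vertical (x := reflection x) (y := reflection y) h.reflect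
        (isVerticalFaultLine_reflect.2 hb)
        (fun j hj => hv ⟨j, isHorizontalFaultLine_reflect.1 hj⟩)
      simpa using eqvGen_reflection this
    · have hxy : x = y := Subtype.ext (funext fun p => h.2 fun hp =>
        hp.elim (fun h1 => hv ⟨_, h1⟩) fun h1 => hh ⟨_, h1⟩)
      rw [hxy]
      exact .refl _

end Robinson

namespace Robinson

open Topology CubeSystem Filter

/-! ### Automorphisms of the minimal Robinson system -/

theorem reflect_blowup (t : Tile) : reflect (blowup t) = blowup t.transpose := by
  funext ⟨i, j⟩
  exact blowup_transpose t j i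

section Automorphism

variable {φ : minimalShift → minimalShift} (hφ : Continuous φ)
  (hcomm : ∀ (n m : ℤ) (x : minimalShift), φ ((S ^ n) ((T ^ m) x)) = (S ^ n) ((T ^ m) (φ x)))

/-- The point of the minimal Robinson system with fault lines through the origin and a given tile
at the origin. -/
def centred (t : Tile) : minimalShift := ⟨blowup t, blowup_mem_minimalShift t⟩

@[simp] theorem coe_centred (t : Tile) : (centred t : Config) = blowup t := rfl

include hφ in
theorem exists_near_map (x : minimalShift) (R : ℤ) :
    ∃ R' : ℤ, 0 ≤ R' ∧ ∀ y, Near R' y x → Near R (φ y) (φ x) :=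
  exists_near_subset (hφ.continuousAt.preimage_mem_nhds (near_mem_nhds R (φ x)))

include hφ hcomm

theorem map_mem_cubes {x₀ x₁ x₂ x₃ : minimalShift} (h : (x₀, x₁, x₂, x₃) ∈ cubes S T) :
    (φ x₀, φ x₁, φ x₂, φ x₃) ∈ cubes S T := by
  refine map_mem_closure (f := fun w : minimalShift × minimalShift × minimalShift × minimalShift =>
    (φ w.1, φ w.2.1, φ w.2.2.1, φ w.2.2.2)) (by fun_prop) h ?_
  rintro _ ⟨z, n, m, rfl⟩
  refine ⟨φ z, n, m, ?_⟩
  have h1 := hcomm n 0 z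
  have h2 := hcomm 0 m z
  simp only [zpow_zero, Homeomorph.one_apply] at h1 h2
  simp only [h1, h2, hcomm]

theorem coincideOffFaultLines_map {x y : minimalShift} (h : CoincideOffFaultLines (x : Config) y) :
    CoincideOffFaultLines (φ x : Config) (φ y) := by
  rw [← eqvGen_iff] at h ⊢
  induction h with
  | rel x y h =>
    obtain ⟨⟨a, ha⟩, b, hb⟩ := h
    exact .rel _ _ ⟨⟨_, map_mem_cubes hφ hcomm ha⟩, _, map_mem_cubes hφ hcomm hb⟩
  | refl x => exact .refl _
  | symm x y _ ih => exact .symm _ _ ih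
  | trans x y z _ _ ih ih' => exact .trans _ _ _ ih ih'

omit hφ hcomm in
theorem coincideOffFaultLines_centred (t t' : Tile) :
    CoincideOffFaultLines (centred t : Config) (centred t') :=
  eqvGen_iff.1 ((realizes_shift_blowup 0).eqvGen (t := t) (t' := t') (by simp) (by simp))

/-- The images of two points that differ only on the horizontal axis coincide far up on every
column. -/
theorem exists_map_eq {t t' : Tile} (ht : t.top = t'.top) (i : ℤ) :
    ∃ j : ℤ, (φ (centred t) : Config) (i, j) = (φ (centred t') : Config) (i, j) := by
  -- Far up the two points show the same tiles, so translates of both are close to `u`, and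
  -- continuity at `u` makes the images agree.
  obtain ⟨u, hu⟩ := exists_clusterPt_of_compactSpace
    (Filter.map (fun N : ℤ => (S ^ i) ((T ^ N) (centred t))) atTop)
  obtain ⟨R, hR0, hR⟩ := exists_near_map hφ u 0
  have hfr := (mapClusterPt_iff_frequently.1 hu) _ (near_mem_nhds R u)
  obtain ⟨N, hN, hRN⟩ := (hfr.and_eventually (eventually_gt_atTop R)).exists
  have hN' : Near R ((S ^ i) ((T ^ N) (centred t'))) u := by
    refine Set.EqOn.trans (fun p hp => ?_) hN
    rw [coe_S_zpow_T_zpow, coe_S_zpow_T_zpow]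
    have := neg_le_of_abs_le hp.2
    have h2 : 0 < p.2 + N := by lia
    simp [blowup, h2, h2.ne', ht]
  refine ⟨N, ?_⟩
  have h1 := hR _ hN zero_mem_box
  have h2 := hR _ hN' zero_mem_box
  rw [hcomm, coe_S_zpow_T_zpow] at h1 h2
  simpa using h1.trans h2.symm

/-- The tiles `t₁`, `t₂` have the same upper mark. Without horizontal fault lines the images of
their blow-ups could differ only on a vertical fault line, where both are constant; they agree
somewhere on it, so they would be equal, against injectivity. -/
theorem exists_isHorizontalFaultLine_map (hinj : Function.Injective φ) (t : Tile) :
    ∃ b, IsHorizontalFaultLine (φ (centred t) : Config) b := by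
  by_contra! hb
  set t₁ : Tile := .verticalArm true 0 true
  set t₂ : Tile := .verticalArm true 0 false
  have hb' : ∀ s j, ¬ IsHorizontalFaultLine (φ (centred s) : Config) j := fun s j hj =>
    hb j ((coincideOffFaultLines_map hφ hcomm
      (coincideOffFaultLines_centred s t)).isHorizontalFaultLine (Subtype.coe_prop _)
      (Subtype.coe_prop _) hj)
  have h12 := coincideOffFaultLines_map hφ hcomm (coincideOffFaultLines_centred t₁ t₂)
  have hne : φ (centred t₁) = φ (centred t₂) := by
    refine Subtype.ext (funext fun p => ?_)
    by_cases hp : p ∈ faultSet (φ (centred t₁) : Config)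
    · rcases hp with hv | hh
      · obtain ⟨m, hm⟩ := exists_forall_eq_vertical (Subtype.coe_prop _) hv (hb' t₁)
        obtain ⟨m', hm'⟩ := exists_forall_eq_vertical (Subtype.coe_prop _)
          (h12.isVerticalFaultLine (Subtype.coe_prop _) (Subtype.coe_prop _) hv) (hb' t₂)
        obtain ⟨j, hj⟩ := exists_map_eq hφ hcomm (t := t₁) (t' := t₂) rfl p.1
        rw [hm, hm'] at hj
        exact (hm p.2).trans (hj.trans (hm' p.2).symm)
      · exact absurd hh (hb' t₁ _)
    · exact h12.2 hp
  have := congrFun (congrArg Subtype.val (hinj hne)) 0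
  simp [blowup, t₁, t₂] at this

theorem exists_isVerticalFaultLine_map (hinj : Function.Injective φ) (t : Tile) :
    ∃ a, IsVerticalFaultLine (φ (centred t) : Config) a := by
  have hr : Function.Injective reflection := Function.LeftInverse.injective reflection_reflection
  obtain ⟨b, hb⟩ := exists_isHorizontalFaultLine_map (φ := reflection ∘ φ ∘ reflection)
    (continuous_reflection.comp (hφ.comp continuous_reflection))
    (fun n m x => by simp [reflection_shift, hcomm])
    (hr.comp (hinj.comp hr)) t.transpose
  refine ⟨b, ?_⟩
  have h1 : reflection (centred t.transpose) = centred t :=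
    Subtype.ext ((reflect_blowup _).trans (by simp))
  simp only [Function.comp_apply, h1] at hb
  exact isHorizontalFaultLine_reflect.1 hb

/-- The image of one blow-up is a translate of a blow-up of a possibly different tile `t'`. Every
point is a limit of translates of the first one whose axes leave every window, so `t'` does not
matter. -/
theorem exists_eq_zpow (hinj : Function.Injective φ) :
    ∃ n m : ℤ, ∀ x, φ x = (S ^ n) ((T ^ m) x) := by
  let t : Tile := .cross true true
  obtain ⟨a, ha⟩ := exists_isVerticalFaultLine_map hφ hcomm hinj t
  obtain ⟨b, hb⟩ := exists_isHorizontalFaultLine_map hφ hcomm hinj t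
  have heq := eq_shift_blowup (Subtype.coe_prop _) ha hb
  set t' := (φ (centred t) : Config) (a, b)
  refine ⟨-a, -b, fun x => Subtype.ext (funext fun p => ?_)⟩
  obtain ⟨R, -, hR⟩ := exists_near_map hφ x (|p.1| + |p.2|)
  obtain ⟨c, hc⟩ := x.2 (max R (|p.1| + |p.2| + |a| + |b|))
  have hy : Near R ((S ^ c.1) ((T ^ c.2) (centred t))) x := by
    rw [Near, coe_S_zpow_T_zpow]
    exact (near_shift_blowup hc t).mono (box_mono (le_max_left _ _))
  have h1 := hR _ hy (mem_box_self p)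
  rw [hcomm, coe_S_zpow_T_zpow, heq, shift_shift] at h1
  have h2 : p + (-a, -b) ∈ box (max R (|p.1| + |p.2| + |a| + |b|)) :=
    ⟨by simp only [Prod.fst_add]; grind, by simp only [Prod.snd_add]; grind⟩
  -- The pattern of `x` around `c` is seen equally well in the blow-up of `t'`.
  rw [← h1, coe_S_zpow_T_zpow, shift_apply, shift_apply, ← near_shift_blowup hc t' h2, shift_apply]
  congr 1
  rw [add_assoc, add_comm (-a, -b)]

end Automorphism

theorem exists_eq_zpow_of_mem_automorphismGroup {φ : minimalShift ≃ₜ minimalShift}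
    (hφ : φ ∈ automorphismGroup S T) : ∃ n m : ℤ, φ = S ^ n * T ^ m := by
  obtain ⟨n, m, h⟩ := exists_eq_zpow (φ := φ) φ.continuous (fun n m x => by
    have := Subgroup.mem_centralizer_iff.1 hφ _ (mul_zpow_mem_actingGroup S T n m)
    exact (congrArg (fun g : minimalShift ≃ₜ minimalShift => g x) this).symm) φ.injective
  exact ⟨n, m, Homeomorph.ext h⟩

theorem automorphismGroup_eq : automorphismGroup S T = Subgroup.closure {S, T} := by
  refine le_antisymm (fun φ hφ => ?_) ?_
  · obtain ⟨n, m, rfl⟩ := exists_eq_zpow_of_mem_automorphismGroup hφ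
    exact mul_zpow_mem_actingGroup S T n m
  · have hST : S * T = T * S := isSubshift_minimalShift.σ₁_mul_σ₂
    refine (Subgroup.closure_le _).2 fun g hg => Subgroup.mem_centralizer_iff.2 fun h hh => ?_
    have : Subgroup.closure {S, T} ≤ Subgroup.centralizer {g} := by
      refine (Subgroup.closure_le _).2 fun h hh => Subgroup.mem_centralizer_iff.2 ?_
      rintro _ rfl
      rcases hg with rfl | rfl <;> rcases hh with rfl | rfl <;>
        first | rfl | exact hST | exact hST.symm
    exact (Subgroup.mem_centralizer_iff.1 (this hh) g rfl).symm

end Robinson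

theorem mainTheorem5 :
    (∃! X : Set Robinson.Config, Robinson.IsMinimalSubsystem Robinson.robinsonShift X) ∧
    ∀ (X : Set Robinson.Config)
      (hX : Robinson.IsMinimalSubsystem Robinson.robinsonShift X),
      (∀ x y : X, CubeSystem.relST hX.isSubshift.σ₁ hX.isSubshift.σ₂ x y →
        Robinson.CoincideOffFaultLines (x : Robinson.Config) (y : Robinson.Config)) ∧
      (∀ x y : X, Robinson.faultSet (x : Robinson.Config) = ∅ →
        CubeSystem.relST hX.isSubshift.σ₁ hX.isSubshift.σ₂ x y → x = y) ∧
      (∀ x y : X,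
        Relation.EqvGen (CubeSystem.relST hX.isSubshift.σ₁ hX.isSubshift.σ₂) x y ↔
          Robinson.CoincideOffFaultLines (x : Robinson.Config) (y : Robinson.Config)) ∧
      CubeSystem.automorphismGroup hX.isSubshift.σ₁ hX.isSubshift.σ₂ =
        Subgroup.closure {hX.isSubshift.σ₁, hX.isSubshift.σ₂} ∧
      (∀ φ ∈ CubeSystem.automorphismGroup hX.isSubshift.σ₁ hX.isSubshift.σ₂,
        ∃ n m : ℤ, φ = hX.isSubshift.σ₁ ^ n * hX.isSubshift.σ₂ ^ m) := by
  refine ⟨⟨_, Robinson.isMinimalSubsystem_minimalShift, fun X hX => Robinson.eq_minimalShift hX⟩,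
    fun X hX => ?_⟩
  obtain rfl := Robinson.eq_minimalShift hX
  have h1 : ∀ x y : Robinson.minimalShift, CubeSystem.relST Robinson.S Robinson.T x y →
      Robinson.CoincideOffFaultLines (x : Robinson.Config) (y : Robinson.Config) :=
    fun x y h => Robinson.eqvGen_iff.1 (.rel _ _ h)
  refine ⟨h1, fun x y hx h => Subtype.ext (funext fun p => (h1 x y h).2 ?_),
    fun x y => Robinson.eqvGen_iff, Robinson.automorphismGroup_eq,
    fun φ hφ => Robinson.exists_eq_zpow_of_mem_automorphismGroup hφ⟩
  simp [hx]
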